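/- Let $F,F'\in\mathbb C[X,Y,Z]$ be nonzero homogeneous polynomials and let $m\in\mathbb P^2(\mathbb C)$ be a point lying on both plane curves $\mathcal C=V(F)$ and $\mathcal C'=V(F')$. The intersection number $i_m(\mathcal C,\mathcal C')\in\mathbb N\cup\{\infty\}$ is the length of $(\mathbb C[X,Y,Z]/(F,F'))_{\mathfrak p}$ over $\mathbb C[X,Y,Z]_{\mathfrak p}$, where $\mathfrak p$ is the homogeneous prime ideal of $m$. Put $P_0=[0:0:1]$. Let $M\in GL(\mathbb C^3)$ map $P_0$ to $m$ and be such that the tangent cones at $P_0$ of $V(F\circ M)$ and of $V(F'\circ M)$ do not contain the line $X=0$. Let $B_1,\dots,B_b\in\mathbb C\langle x,y\rangle$ be equations of the branches of $V(F\circ M)$ at $P_0$, that is, $F\circ M(x,y,1)$ is a unit times $\prod_\beta B_\beta$ with each $B_\beta$ irreducible in the ring $\mathbb C\langle x,y\rangle$ of convergent power series. Let $e_\beta$ be the multiplicity (the lowest degree of a monomial) of $B_\beta$, and let $x=t^{e_\beta},\ y=h_\beta(t)$ be a Puiseux parametrization of the $\beta$-th branch, where $h_\beta$ is a convergent power series with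 $h_\beta(0)=0$ and $B_\beta(t^{e_\beta},h_\beta(t))=0$. Let $B'_{\beta'}$, $e'_{\beta'}$, $h'_{\beta'}$ ($1\le\beta'\le b'$) be the analogous data for $V(F'\circ M)$. Put $\zeta_\beta=e^{2i\pi/e_\beta}$ and $\zeta'_{\beta'}=e^{2i\pi/e'_{\beta'}}$; then $y=h_\beta(\zeta_\beta^{\,j}x^{1/e_\beta})$, $0\le j<e_\beta$, are the probranches of the $\beta$-th branch. For a series $g=\sum_{q\in\mathbb Q_{\ge 0}}a_qx^q$ let $\mathrm{val}_x(g)=\min\{q: a_q\neq 0\}$, and $\mathrm{val}_x(0)=\infty$. Then, in $\mathbb Q\cup\{\infty\}$, $$i_m(\mathcal C,\mathcal C')=\sum_{\beta=1}^{b}\sum_{j=0}^{e_\beta-1}\sum_{\beta'=1}^{b'}\sum_{j'=0}^{e'_{\beta'}-1}\mathrm{val}_x\!\left[h_\beta(\zeta_\beta^{\,j}x^{1/e_\beta})-h'_{\beta'}({\zeta'_{\beta'}}^{j'}x^{1/e'_{\beta'}})\right].$$ Consequently $$i_m(\mathcal C,\mathcal C')=\sum_{\beta=1}^{b} i_{P_0}(\mathcal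 B_\beta,V(F'\circ M)),$$ where the intersection number of the $\beta$-th branch $\mathcal B_\beta$ with $V(F'\circ M)$ is $i_{P_0}(\mathcal B_\beta,V(F'\circ M))=\mathrm{ord}_t\,F'\circ M(t^{e_\beta},h_\beta(t),1)$, and it satisfies, for every $\beta$, $$i_{P_0}(\mathcal B_\beta,V(F'\circ M))=\sum_{j=0}^{e_\beta-1}\mathrm{val}_x\!\left(F'\circ M\big(x,h_\beta(\zeta_\beta^{\,j}x^{1/e_\beta}),1\big)\right).$$ -/

import Mathlib

open scoped LinearAlgebra.Projectivization

noncomputable section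

namespace PlaneCurve

/-! ### Plane projective curves and their intersection numbers -/

/-- The projective plane over `ℂ`. -/
abbrev Plane : Type := ℙ ℂ (Fin 3 → ℂ)

/-- The zero locus `V(F)` in the projective plane of a homogeneous polynomial `F`. -/
def zeroLocus (F : MvPolynomial (Fin 3) ℂ) : Set Plane :=
  {p | ∀ v ∈ p.submodule, MvPolynomial.eval v F = 0}

/-- The homogeneous prime ideal of a point `m` of the projective plane: the kernel of the
restriction of polynomials to the line of `ℂ³` that `m` is. -/
def pointIdeal (m : Plane) : Ideal (MvPolynomial (Fin 3) ℂ) :=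
  RingHom.ker (MvPolynomial.aeval
    (fun i => Polynomial.C (m.rep i) * Polynomial.X : Fin 3 → Polynomial ℂ))

instance (m : Plane) : (pointIdeal m).IsPrime := RingHom.ker_isPrime _

/-- The intersection number at `m` of the plane curves `V(F)` and `V(F')`: the length of
`(ℂ[X,Y,Z]/(F,F'))_𝔭` over `ℂ[X,Y,Z]_𝔭`, where `𝔭` is the homogeneous prime ideal of `m`.
It is infinite exactly when the two curves share a component through `m`. -/
def intersectionNumber (m : Plane) (F F' : MvPolynomial (Fin 3) ℂ) : ℕ∞ :=
  Module.length (Localization.AtPrime (pointIdeal m))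
    (Localization.AtPrime (pointIdeal m) ⧸
      (Ideal.span {F, F'}).map
        (algebraMap (MvPolynomial (Fin 3) ℂ) (Localization.AtPrime (pointIdeal m))))

/-! ### Linear changes of coordinates -/

theorem mulVec_ne_zero (M : GL (Fin 3) ℂ) :
    (M : Matrix (Fin 3) (Fin 3) ℂ).mulVec ![0, 0, 1] ≠ 0 := by
  intro h
  have h1 := congrArg ((M⁻¹ : GL (Fin 3) ℂ) : Matrix (Fin 3) (Fin 3) ℂ).mulVec h
  rw [Matrix.mulVec_mulVec, ← Units.val_mul, inv_mul_cancel, Matrix.mulVec_zero, Units.val_one,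
    Matrix.one_mulVec] at h1
  simpa using congrFun h1 2

/-- The image by `M` of the point `P₀ = [0 : 0 : 1]`. -/
def imageOrigin (M : GL (Fin 3) ℂ) : Plane :=
  Projectivization.mk ℂ ((M : Matrix (Fin 3) (Fin 3) ℂ).mulVec ![0, 0, 1]) (mulVec_ne_zero M)

/-- The polynomial `F ∘ M`. -/
def comp (F : MvPolynomial (Fin 3) ℂ) (M : GL (Fin 3) ℂ) : MvPolynomial (Fin 3) ℂ :=
  MvPolynomial.bind₁ (fun i => ∑ j, MvPolynomial.C (M i j) * MvPolynomial.X j) F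

/-- The polynomial `G(x, y, 1)`, an equation of `V(G)` in the chart `z = 1`. -/
def localEquation (G : MvPolynomial (Fin 3) ℂ) : MvPolynomial (Fin 2) ℂ :=
  MvPolynomial.aeval ![MvPolynomial.X 0, MvPolynomial.X 1, 1] G

/-- The tangent cone at `P₀` of `V(G)`, in the coordinates `(x, y)` of the chart `z = 1`: the zero
set of the nonzero homogeneous component of lowest degree of `G(x, y, 1)`. -/
def tangentCone (G : MvPolynomial (Fin 3) ℂ) : Set (Fin 2 → ℂ) :=
  {v | MvPolynomial.eval v (MvPolynomial.homogeneousComponent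
    (localEquation G : MvPowerSeries (Fin 2) ℂ).order.toNat (localEquation G)) = 0}

/-- The line `x = 0` in the chart `z = 1`. -/
def lineX : Set (Fin 2 → ℂ) := {v | v 0 = 0}

/-! ### Convergent power series -/

/-- A power series converges if it converges absolutely on some polydisc. -/
def IsConvergent {σ : Type} (f : MvPowerSeries σ ℂ) : Prop :=
  ∃ r : ℝ, 0 < r ∧ Summable fun n : σ →₀ ℕ => ‖MvPowerSeries.coeff n f‖ * r ^ n.degree

theorem IsConvergent.mono {σ : Type} {f : MvPowerSeries σ ℂ} {r s : ℝ}
    (hf : Summable fun n : σ →₀ ℕ => ‖MvPowerSeries.coeff n f‖ * r ^ n.degree)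
    (hs : 0 < s) (hsr : s ≤ r) :
    Summable fun n : σ →₀ ℕ => ‖MvPowerSeries.coeff n f‖ * s ^ n.degree :=
  hf.of_nonneg_of_le (fun n => by positivity) (fun n => by gcongr)

theorem IsConvergent.add {σ : Type} {f g : MvPowerSeries σ ℂ} (hf : IsConvergent f)
    (hg : IsConvergent g) : IsConvergent (f + g) := by
  obtain ⟨r, hr, hf⟩ := hf
  obtain ⟨s, hs, hg⟩ := hg
  have h0 : 0 < min r s := lt_min hr hs
  refine ⟨min r s, h0, ((IsConvergent.mono hf h0 (min_le_left _ _)).add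
    (IsConvergent.mono hg h0 (min_le_right _ _))).of_nonneg_of_le
    (fun n => by positivity) (fun n => ?_)⟩
  rw [map_add, ← add_mul]
  gcongr
  exact norm_add_le _ _

theorem IsConvergent.mul {σ : Type} {f g : MvPowerSeries σ ℂ} (hf : IsConvergent f)
    (hg : IsConvergent g) : IsConvergent (f * g) := by
  classical
  obtain ⟨r, hr, hf⟩ := hf
  obtain ⟨s, hs, hg⟩ := hg
  have h0 : 0 < min r s := lt_min hr hs
  have key := summable_sum_mul_antidiagonal_of_summable_mul
    (Summable.mul_of_nonneg (IsConvergent.mono hf h0 (min_le_left _ _))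
    (IsConvergent.mono hg h0 (min_le_right _ _)) (fun n => by positivity) (fun n => by positivity))
  refine ⟨min r s, h0, key.of_nonneg_of_le (fun n => by positivity) (fun n => ?_)⟩
  rw [MvPowerSeries.coeff_mul]
  refine (mul_le_mul_of_nonneg_right (norm_sum_le _ _) (by positivity)).trans (le_of_eq ?_)
  rw [Finset.sum_mul]
  refine Finset.sum_congr rfl (fun kl hkl => ?_)
  have hn : kl.1 + kl.2 = n := by simpa using hkl
  rw [← hn, map_add, pow_add, norm_mul]
  ring

theorem isConvergent_coe {σ : Type} (f : MvPolynomial σ ℂ) :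
    IsConvergent (f : MvPowerSeries σ ℂ) := by
  refine ⟨1, one_pos, summable_of_ne_finset_zero (s := f.support) (fun n hn => ?_)⟩
  simpa [MvPolynomial.coeff_coe] using hn

/-- The ring of convergent power series in the variables `σ`; `ℂ⟨x, y⟩` is
`ConvergentSeries (Fin 2)`. -/
def ConvergentSeries (σ : Type) : Subalgebra ℂ (MvPowerSeries σ ℂ) where
  carrier := {f | IsConvergent f}
  mul_mem' := IsConvergent.mul
  add_mem' := IsConvergent.add
  algebraMap_mem' c := by
    have h := isConvergent_coe (MvPolynomial.C c : MvPolynomial σ ℂ)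
    rwa [MvPolynomial.coe_C] at h

/-- The germ at `P₀` of the local equation `G(x, y, 1)` of `V(G)`. -/
def germ (G : MvPolynomial (Fin 3) ℂ) : ConvergentSeries (Fin 2) :=
  ⟨(localEquation G : MvPowerSeries (Fin 2) ℂ), isConvergent_coe _⟩

/-! ### Branches and probranches -/

/-- `B` is the list of (equations of) the branches of `V(G)` at `P₀`: the irreducible factors in
`ℂ⟨x, y⟩` of the germ of `G(x, y, 1)`, each repeated as often as it divides the germ. -/
structure IsBranches (G : MvPolynomial (Fin 3) ℂ) {b : ℕ}
    (B : Fin b → ConvergentSeries (Fin 2)) : Prop where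
  irreducible : ∀ β, Irreducible (B β)
  associated : Associated (germ G) (∏ β, B β)

/-- The multiplicity at the origin of the branch `B = 0`: the lowest degree of a monomial in `B`. -/
def branchMultiplicity (B : ConvergentSeries (Fin 2)) : ℕ :=
  (B : MvPowerSeries (Fin 2) ℂ).order.toNat

/-- `x = tᵉ, y = h(t)` is a Puiseux parametrization of the branch `B = 0`, where `e` is the
multiplicity of the branch and `h` is a convergent power series without constant term. -/
structure IsParametrization (B : ConvergentSeries (Fin 2)) (h : PowerSeries ℂ) : Prop where
  convergent : h ∈ ConvergentSeries Unit
  constantCoeff : PowerSeries.constantCoeff h = 0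
  vanish : MvPowerSeries.subst (![PowerSeries.X ^ branchMultiplicity B, h] : Fin 2 → PowerSeries ℂ)
    (B : MvPowerSeries (Fin 2) ℂ) = 0

/-- The field in which series `∑ a_q x^q` with rational exponents are computed; it contains the
ring `ℂ⟨x^*⟩` of convergent power series in some `x^{1/N}`. The valuation
`val_x = min {q | a_q ≠ 0}` is `HahnSeries.orderTop`, with value `⊤` at `0`. -/
abbrev Puiseux : Type := HahnSeries ℚ ℂ

/-- The series `h(ζ^j x^{1/e})` with `ζ = exp(2iπ/e)`. -/
def probranch (e : ℕ) (h : PowerSeries ℂ) (j : ℕ) : Puiseux :=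
  PowerSeries.heval
    (HahnSeries.single (1 / (e : ℚ)) (Complex.exp (2 * Real.pi * Complex.I / e) ^ j)) h

/-- `G(x, g(x), 1)` for a series `g` with rational exponents. -/
def evalAlong (G : MvPolynomial (Fin 3) ℂ) (g : Puiseux) : Puiseux :=
  MvPolynomial.aeval ![HahnSeries.single 1 1, g, 1] G

/-- The intersection number at `P₀` of the branch parametrized by `x = tᵉ, y = h(t)` with the curve
`V(G)`: the order in `t` of `G(tᵉ, h(t), 1)`. -/
def branchIntersection (e : ℕ) (h : PowerSeries ℂ) (G : MvPolynomial (Fin 3) ℂ) : ℕ∞ :=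
  (MvPolynomial.aeval (![PowerSeries.X ^ e, h, 1] : Fin 3 → PowerSeries ℂ) G).order

/-- The inclusion of `ℕ ∪ {∞}` in `ℚ ∪ {∞}`. -/
def toRat (n : ℕ∞) : WithTop ℚ := ENat.map (fun k : ℕ => (k : ℚ)) n

end PlaneCurve

end

/-! The local ring at the homogeneous prime of `m` has residue field `ℂ(z)`, the function field of
the line in `ℂ³` that `m` is, and its completion is `ℂ(z)⟦x, y⟧`, reached by `P ↦ (P ∘ M)(zx, zy,
z)`. Passing to the completion does not change lengths (`length_quotient_eq_of_dense`), and
homogeneity turns `F` into the unit `z ^ d` times `f = F ∘ M(x, y, 1)`. Hence `i_m` is the dimension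
over `ℂ(z)` of `ℂ(z)⟦x, y⟧/(f, f')` (`intersectionNumber_eq_length`).

Let `N` be a common multiple of the multiplicities `e_β`. After `x = t ^ N` the series `f` is a unit
times the product of the factors `y - c(t)`, where `c` runs through the series `h_β(ζ_βʲ t ^ (N /
e_β))` (`exists_ramify_localEquation`). The substitution multiplies the dimension by `N`, because
`K⟦t, y⟧` is free of rank `N` over `K⟦x, y⟧` (`length_quotient_ramify`). Dimension is additive over
the prime factors `y - c(t)`, and each contributes `ord_t f'(t ^ N, c(t))`
(`length_quotient_prod_linearFactor`). This order is `N / e_β` times that of `F' ∘ M(t ^ e_β,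
h_β(t), 1)`; summing over the `e_β` conjugates and cancelling `N` gives the sum over branches. The
formula with probranches follows by factoring `f'` as well and using that the valuation of a product
is the sum of the valuations.

The factorisation of a branch `B` (`ramify_eq_prod_linearFactor`) is a Galois argument. The product
of the distinct conjugate factors `y - h(ζʲ t)` divides `B(t ^ e, y)` and is invariant under `t ↦ ζ
t`, so it descends to a divisor `Q(x, y)` of `B`. Since `B` is irreducible only among convergent
series, the quotient `B / Q` must be shown to converge (`isConvergent_of_mul`). It is then a unit,
and the tangent cone condition, which makes the order of `B(0, y)` equal to `e`, forces the number
of factors to be exactly `e`. -/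

namespace PlaneCurve

open MvPowerSeries

/-! ### Substituting a series for `y`, and divisibility by `y - c(x)` -/

section Substitution

variable {K : Type*} [Field K]

/-- The series `c(x)` in `K⟦x, y⟧`, for `c` in `K⟦t⟧`. -/
noncomputable def inX : PowerSeries K →ₐ[K] MvPowerSeries (Fin 2) K :=
  MvPowerSeries.rename (fun _ : Unit => (0 : Fin 2))

/-- The series `y - c(x)`. -/
noncomputable def linearFactor (c : PowerSeries K) : MvPowerSeries (Fin 2) K :=
  X 1 - inX c

theorem hasSubst_pair {τ : Type*} [Finite τ] {a b : MvPowerSeries τ K}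
    (ha : constantCoeff a = 0) (hb : constantCoeff b = 0) :
    HasSubst (![a, b] : Fin 2 → MvPowerSeries τ K) :=
  hasSubst_of_constantCoeff_zero (fun i => by fin_cases i <;> simpa)

theorem inX_eq_subst (c : PowerSeries K) :
    inX c = MvPowerSeries.subst (fun _ : Unit => (X 0 : MvPowerSeries (Fin 2) K)) c := by
  rw [inX, rename_eq_subst]; rfl

theorem hasSubst_inX : HasSubst (fun _ : Unit => (X 0 : MvPowerSeries (Fin 2) K)) :=
  hasSubst_of_constantCoeff_zero (by simp)

theorem constantCoeff_inX (c : PowerSeries K) :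
    constantCoeff (inX c) = PowerSeries.constantCoeff c :=
  constantCoeff_rename (f := fun _ : Unit => (0 : Fin 2)) c

theorem subst_inX {τ : Type*} [Finite τ] {a b : MvPowerSeries τ K}
    (ha : constantCoeff a = 0) (hb : constantCoeff b = 0) (c : PowerSeries K) :
    subst ![a, b] (inX c) = PowerSeries.subst a c := by
  rw [inX_eq_subst, subst_comp_subst_apply hasSubst_inX (hasSubst_pair ha hb)]
  simp [subst_X (hasSubst_pair ha hb), PowerSeries.subst]

theorem constantCoeff_powerSeriesX : MvPowerSeries.constantCoeff (PowerSeries.X : PowerSeries K) = 0 :=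
  PowerSeries.constantCoeff_X

theorem constantCoeff_powerSeriesX_pow {N : ℕ} (hN : N ≠ 0) :
    MvPowerSeries.constantCoeff (PowerSeries.X ^ N : PowerSeries K) = 0 := by
  rw [map_pow, constantCoeff_powerSeriesX, zero_pow hN]

/-- The substitution `x = t, y = c(t)`. -/
noncomputable def evalAt (c : PowerSeries K) (hc : PowerSeries.constantCoeff c = 0) :
    MvPowerSeries (Fin 2) K →ₐ[K] PowerSeries K :=
  substAlgHom (hasSubst_pair (constantCoeff_powerSeriesX) hc)

theorem evalAt_apply (c : PowerSeries K) (hc : PowerSeries.constantCoeff c = 0)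
    (f : MvPowerSeries (Fin 2) K) : evalAt c hc f = subst ![PowerSeries.X, c] f := by
  rw [evalAt, substAlgHom_apply]

theorem evalAt_inX (c : PowerSeries K) (hc : PowerSeries.constantCoeff c = 0)
    (p : PowerSeries K) : evalAt c hc (inX p) = p := by
  rw [evalAt_apply, subst_inX constantCoeff_powerSeriesX hc]
  exact congrFun MvPowerSeries.subst_self p

theorem evalAt_X_one (c : PowerSeries K) (hc : PowerSeries.constantCoeff c = 0) :
    evalAt c hc (X 1) = c := by
  rw [evalAt_apply, subst_X (hasSubst_pair constantCoeff_powerSeriesX hc)]; rfl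

theorem evalAt_linearFactor (c : PowerSeries K) (hc : PowerSeries.constantCoeff c = 0)
    (p : PowerSeries K) : evalAt c hc (linearFactor p) = c - p := by
  rw [linearFactor, map_sub, evalAt_X_one, evalAt_inX]

theorem evalAt_surjective (c : PowerSeries K) (hc : PowerSeries.constantCoeff c = 0) :
    Function.Surjective (evalAt c hc) := fun p => ⟨inX p, evalAt_inX c hc p⟩

theorem coeff_evalAt_zero (f : MvPowerSeries (Fin 2) K) (n : ℕ) :
    PowerSeries.coeff n (evalAt 0 (map_zero _) f) = coeff (Finsupp.single 0 n) f := by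
  rw [evalAt_apply, PowerSeries.coeff, coeff_subst (hasSubst_pair constantCoeff_powerSeriesX (map_zero _)),
    finsum_eq_single _ (Finsupp.single 0 n)]
  · rw [Finsupp.prod_single_index (by simp)]
    have := PowerSeries.coeff_X_pow_self (R := K) n
    rw [PowerSeries.coeff] at this
    simp [this]
  · intro d hd
    rw [Finsupp.prod_fintype _ _ (by simp)]
    simp only [Fin.prod_univ_two, Matrix.cons_val_zero, Matrix.cons_val_one]
    by_cases h1 : d 1 = 0
    · have h0 : d 0 ≠ n := fun h => hd (by ext i; fin_cases i <;> simp [h, h1])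
      have := PowerSeries.coeff_X_pow (R := K) n (d 0)
      rw [PowerSeries.coeff, if_neg (Ne.symm h0)] at this
      simp [h1, this]
    · simp [h1]

theorem linearFactor_zero_dvd {f : MvPowerSeries (Fin 2) K}
    (hf : evalAt 0 (map_zero _) f = 0) : X 1 ∣ f := by
  rw [X_dvd_iff]
  intro m hm
  have : m = Finsupp.single 0 (m 0) := by ext i; fin_cases i <;> simp [hm]
  rw [this, ← coeff_evalAt_zero, hf, map_zero]

/-- The substitution `x = x, y = y + c(x)`. -/
noncomputable def translate (c : PowerSeries K) (hc : PowerSeries.constantCoeff c = 0) :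
    MvPowerSeries (Fin 2) K →ₐ[K] MvPowerSeries (Fin 2) K :=
  substAlgHom (hasSubst_pair (a := X 0) (b := X 1 + inX c) (by simp)
    (by simp [constantCoeff_inX, hc]))

theorem evalAt_translate (c p : PowerSeries K) (hc : PowerSeries.constantCoeff c = 0)
    (hp : PowerSeries.constantCoeff p = 0) (f : MvPowerSeries (Fin 2) K) :
    evalAt p hp (translate c hc f) = evalAt (p + c) (by simp [hc, hp]) f := by
  have h1 := hasSubst_pair (a := X 0) (b := X 1 + inX c) (by simp)
    (by simp [constantCoeff_inX, hc])
  have h2 := hasSubst_pair (K := K) constantCoeff_powerSeriesX hp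
  rw [translate, substAlgHom_apply, evalAt_apply, evalAt_apply, subst_comp_subst_apply h1 h2]
  congr 1
  funext i
  fin_cases i
  · simp [subst_X h2]
  · have := evalAt_inX p hp c
    rw [evalAt_apply] at this
    simp [subst_X h2, subst_add h2, this]

theorem translate_translate (c p : PowerSeries K) (hc : PowerSeries.constantCoeff c = 0)
    (hp : PowerSeries.constantCoeff p = 0) (hcp : c + p = 0) (f : MvPowerSeries (Fin 2) K) :
    translate p hp (translate c hc f) = f := by
  have h1 := hasSubst_pair (a := X 0) (b := X 1 + inX c) (by simp)
    (by simp [constantCoeff_inX, hc])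
  have h2 := hasSubst_pair (a := X 0) (b := X 1 + inX p) (by simp)
    (by simp [constantCoeff_inX, hp])
  rw [translate, translate, substAlgHom_apply, substAlgHom_apply, subst_comp_subst_apply h1 h2]
  conv_rhs => rw [← id_eq (a := f), ← subst_self (σ := Fin 2) (R := K)]
  congr 1
  funext i
  fin_cases i
  · simp [subst_X h2]
  · have h3 : subst ![X 0, X 1 + inX p] (inX c) = inX c := by
      rw [subst_inX (by simp) (by simp [constantCoeff_inX, hp]), inX_eq_subst, PowerSeries.subst]
    simp only [Fin.mk_one, Matrix.cons_val_one, subst_add h2, subst_X h2, h3, Matrix.cons_val_fin_one]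
    rw [add_assoc, ← map_add, add_comm p c, hcp, map_zero, add_zero]

theorem translate_X_one (c : PowerSeries K) (hc : PowerSeries.constantCoeff c = 0) :
    translate c hc (X 1) = X 1 + inX c := by
  rw [translate, substAlgHom_X]; rfl

/-- The automorphism `y ↦ y + c(x)` carries `y - c(x)` to `y`, which reduces the claim to `c = 0`: a
series vanishing at `y = 0` is divisible by `y`. -/
theorem linearFactor_dvd_iff (c : PowerSeries K) (hc : PowerSeries.constantCoeff c = 0)
    (f : MvPowerSeries (Fin 2) K) : linearFactor c ∣ f ↔ evalAt c hc f = 0 := by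
  constructor
  · rintro ⟨g, rfl⟩
    rw [map_mul, evalAt_linearFactor, sub_self, zero_mul]
  · intro h
    have h0 : evalAt 0 (map_zero _) (translate c hc f) = 0 := by
      rw [evalAt_translate]
      simpa using h
    obtain ⟨g, hg⟩ := linearFactor_zero_dvd h0
    have hc' : PowerSeries.constantCoeff (-c) = 0 := by simp [hc]
    refine ⟨translate (-c) hc' g, ?_⟩
    rw [← translate_translate c (-c) hc hc' (by simp) f, hg, map_mul, translate_X_one, map_neg,
      ← sub_eq_add_neg, linearFactor]

theorem linearFactor_ne_zero (c : PowerSeries K) : linearFactor c ≠ 0 := by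
  intro h
  have := congrArg (coeff (Finsupp.single (1 : Fin 2) 1)) h
  have h2 : coeff (Finsupp.single (1 : Fin 2) 1) (inX c) = 0 := by
    refine coeff_rename_eq_zero _ _ ?_
    rintro ⟨y, hy⟩
    have := DFunLike.congr_fun hy 1
    rw [Finsupp.mapDomain_of_notMem_range] at this <;> simp at this ⊢
  rw [linearFactor, map_sub, h2] at this
  simp at this

end Substitution

/-! ### The ramified substitution `x = t ^ N` -/

section Ramification

variable {K : Type*} [Field K]

theorem hasSubst_ramify {N : ℕ} (hN : N ≠ 0) :
    HasSubst (![X 0 ^ N, X 1] : Fin 2 → MvPowerSeries (Fin 2) K) :=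
  hasSubst_pair (by simp [hN]) (by simp)

/-- The substitution `x = t ^ N, y = y`. -/
noncomputable def ramify {N : ℕ} (hN : N ≠ 0) :
    MvPowerSeries (Fin 2) K →ₐ[K] MvPowerSeries (Fin 2) K :=
  substAlgHom (hasSubst_ramify hN)

theorem ramify_apply {N : ℕ} (hN : N ≠ 0) (f : MvPowerSeries (Fin 2) K) :
    ramify hN f = subst ![X 0 ^ N, X 1] f := by
  rw [ramify, substAlgHom_apply]

theorem evalAt_ramify {N : ℕ} (hN : N ≠ 0) (c : PowerSeries K)
    (hc : PowerSeries.constantCoeff c = 0) (f : MvPowerSeries (Fin 2) K) :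
    evalAt c hc (ramify hN f) = subst ![PowerSeries.X ^ N, c] f := by
  have h := hasSubst_pair (K := K) constantCoeff_powerSeriesX hc
  rw [ramify_apply, evalAt_apply, subst_comp_subst_apply (hasSubst_ramify hN) h]
  congr 1
  funext i
  fin_cases i
  · simp [subst_X h, subst_pow h]
  · simp [subst_X h]

/-- The exponent `(i, j)`. -/
noncomputable def expo (i j : ℕ) : Fin 2 →₀ ℕ := Finsupp.single 0 i + Finsupp.single 1 j

@[simp] theorem expo_zero (i j : ℕ) : expo i j 0 = i := by simp [expo]

@[simp] theorem expo_one (i j : ℕ) : expo i j 1 = j := by simp [expo]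

theorem expo_eta (n : Fin 2 →₀ ℕ) : expo (n 0) (n 1) = n := by
  ext i; fin_cases i <;> simp

theorem expo_inj {i j k l : ℕ} : expo i j = expo k l ↔ i = k ∧ j = l := by
  constructor
  · intro h
    exact ⟨by simpa using DFunLike.congr_fun h 0, by simpa using DFunLike.congr_fun h 1⟩
  · rintro ⟨rfl, rfl⟩; rfl

/-- The series `∑ a i j xⁱ yʲ`. -/
def ofExpo (a : ℕ → ℕ → K) : MvPowerSeries (Fin 2) K := fun n => a (n 0) (n 1)

@[simp] theorem coeff_ofExpo (a : ℕ → ℕ → K) (i j : ℕ) :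
    coeff (expo i j) (ofExpo a) = a i j := by
  change a (expo i j 0) (expo i j 1) = _
  simp

theorem ext_expo {f g : MvPowerSeries (Fin 2) K}
    (h : ∀ i j, coeff (expo i j) f = coeff (expo i j) g) : f = g := by
  ext n
  rw [← expo_eta n]
  exact h _ _

theorem coeff_ramify {N : ℕ} (hN : N ≠ 0) (f : MvPowerSeries (Fin 2) K) (i j : ℕ) :
    coeff (expo i j) (ramify hN f) = if N ∣ i then coeff (expo (i / N) j) f else 0 := by
  have key (d : Fin 2 →₀ ℕ) : d.prod (fun s k => (![X 0 ^ N, X 1] s : MvPowerSeries (Fin 2) K) ^ k)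
      = monomial (expo (N * d 0) (d 1)) 1 := by
    rw [Finsupp.prod_fintype _ _ (by simp), Fin.prod_univ_two]
    change (X 0 ^ N : MvPowerSeries (Fin 2) K) ^ d 0 * X 1 ^ d 1 = _
    rw [← pow_mul, X_pow_eq, X_pow_eq, monomial_mul_monomial, one_mul, expo]
  rw [ramify_apply, coeff_subst (hasSubst_ramify hN)]
  simp only [key, coeff_monomial, expo_inj]
  rw [finsum_eq_single _ (expo (i / N) j)]
  · by_cases h : N ∣ i
    · simp [h, Nat.mul_div_cancel' h]
    · have : i ≠ N * (i / N) := fun h' => h ⟨_, h'⟩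
      simp [h, this]
  · intro d hd
    rw [if_neg, smul_zero]
    rintro ⟨h1, h2⟩
    apply hd
    rw [h1, h2, Nat.mul_div_cancel_left _ (Nat.pos_of_ne_zero hN), expo_eta]

theorem coeff_mul_expo {N : ℕ} (hN : N ≠ 0) (f : MvPowerSeries (Fin 2) K) (i j : ℕ) :
    coeff (expo (N * i) j) (ramify hN f) = coeff (expo i j) f := by
  rw [coeff_ramify, if_pos (dvd_mul_right _ _), Nat.mul_div_cancel_left _ (Nat.pos_of_ne_zero hN)]

theorem ramify_injective {N : ℕ} (hN : N ≠ 0) : Function.Injective (ramify (K := K) hN) := by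
  intro f g h
  refine ext_expo fun i j => ?_
  rw [← coeff_mul_expo hN, h, coeff_mul_expo]

theorem exists_ramify_eq {N : ℕ} (hN : N ≠ 0) {f : MvPowerSeries (Fin 2) K}
    (h : ∀ i j, coeff (expo i j) f ≠ 0 → N ∣ i) : ∃ g, ramify hN g = f := by
  refine ⟨ofExpo fun i j => coeff (expo (N * i) j) f, ext_expo fun i j => ?_⟩
  rw [coeff_ramify, coeff_ofExpo]
  split_ifs with hi
  · rw [Nat.mul_div_cancel' hi]
  · by_contra h'
    exact hi (h i j (Ne.symm h'))

/-- Descent: the action `t ↦ ζ t` multiplies the coefficient of `tⁱ yʲ` by `ζ ^ i`, so invariance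
leaves only the exponents `i` divisible by `N`. -/
theorem exists_ramify_eq_of_rescale {N : ℕ} (hN : N ≠ 0) {ζ : K} (hζ : IsPrimitiveRoot ζ N)
    {f : MvPowerSeries (Fin 2) K} (h : rescale ![ζ, 1] f = f) : ∃ g, ramify hN g = f := by
  refine exists_ramify_eq hN fun i j hij => ?_
  have := congrArg (coeff (expo i j)) h
  rw [coeff_rescale, Finsupp.prod_fintype _ _ (by simp), Fin.prod_univ_two] at this
  simp only [expo_zero, expo_one, Matrix.cons_val_zero, Matrix.cons_val_one, one_pow, mul_one] at this
  exact (hζ.pow_eq_one_iff_dvd i).1 (mul_right_cancel₀ hij (by simpa using this))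

theorem rescale_ramify {N : ℕ} (hN : N ≠ 0) {ζ : K} (hζ : ζ ^ N = 1) (f : MvPowerSeries (Fin 2) K) :
    rescale ![ζ, 1] (ramify hN f) = ramify hN f := by
  refine ext_expo fun i j => ?_
  rw [coeff_rescale, coeff_ramify, Finsupp.prod_fintype _ _ (by simp), Fin.prod_univ_two]
  split_ifs with h
  · obtain ⟨k, rfl⟩ := h
    simp [pow_mul, hζ]
  · simp

theorem rescale_linearFactor (ζ : K) (c : PowerSeries K) :
    rescale ![ζ, 1] (linearFactor c) = linearFactor (PowerSeries.rescale ζ c) := by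
  have h1 := HasSubst.smul_X (R := K) (![ζ, 1] : Fin 2 → K)
  have h2 : HasSubst (fun _ : Unit => (X 0 : MvPowerSeries (Fin 2) K)) := hasSubst_inX
  rw [linearFactor, map_sub, linearFactor]
  congr 1
  · rw [rescale_eq_subst, subst_X h1]
    simp
  · rw [rescale_eq_subst, inX_eq_subst, subst_comp_subst_apply hasSubst_inX h1, subst_X h1,
      PowerSeries.rescale_eq_subst, PowerSeries.subst, inX_eq_subst, subst_comp_subst_apply _ h2]
    · congr 1
      funext i
      rw [subst_smul h2, PowerSeries.X, subst_X h2]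
      simp
    · exact hasSubst_of_constantCoeff_zero (fun _ => by
        simp [constantCoeff_powerSeriesX])

theorem ramify_mul {M N : ℕ} (hM : M ≠ 0) (hN : N ≠ 0) (f : MvPowerSeries (Fin 2) K) :
    ramify hN (ramify hM f) = ramify (Nat.mul_ne_zero hM hN) f := by
  refine ext_expo fun i j => ?_
  rw [coeff_ramify, coeff_ramify, coeff_ramify]
  by_cases h : N ∣ i
  · obtain ⟨k, rfl⟩ := h
    simp [Nat.mul_div_cancel_left _ (Nat.pos_of_ne_zero hN), mul_comm M N,
      Nat.mul_dvd_mul_iff_left (Nat.pos_of_ne_zero hN), Nat.mul_div_mul_left _ _ (Nat.pos_of_ne_zero hN)]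
  · rw [if_neg h, if_neg (fun h' => h ((dvd_mul_left _ _).trans h'))]

theorem ramify_linearFactor {N : ℕ} (hN : N ≠ 0) (c : PowerSeries K) :
    ramify hN (linearFactor c) = linearFactor (PowerSeries.subst (PowerSeries.X ^ N : PowerSeries K) c) := by
  have h1 := hasSubst_ramify (K := K) hN
  have h2 : HasSubst (fun _ : Unit => (X 0 : MvPowerSeries (Fin 2) K)) := hasSubst_inX
  rw [linearFactor, map_sub, linearFactor, ramify_apply, ramify_apply, subst_X h1]
  congr 1
  rw [subst_inX (by simp [hN]) (by simp), PowerSeries.subst, PowerSeries.subst, inX_eq_subst,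
    subst_comp_subst_apply _ h2]
  · congr 1
    funext i
    simp [subst_pow h2, PowerSeries.X, subst_X h2]
  · exact hasSubst_of_constantCoeff_zero (fun _ => constantCoeff_powerSeriesX_pow hN)

end Ramification

/-! ### Dimensions of quotients of `K⟦x, y⟧` -/

section Length

theorem length_quotient_of_surjective {K R M : Type*} [Field K] [CommRing R] [Algebra K R]
    [AddCommGroup M] [Module K M] (J : Ideal R) (f : R →ₗ[K] M) (hf : Function.Surjective f)
    (hJ : ∀ x, f x = 0 ↔ x ∈ J) : Module.length K (R ⧸ J) = Module.length K M := by
  have h : LinearMap.ker f = J.restrictScalars K := by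
    ext x
    simpa using hJ x
  rw [← (f.quotKerEquivOfSurjective hf).length_eq, h]
  exact (Submodule.Quotient.restrictScalarsEquiv K J).symm.length_eq

theorem length_quotient_anti {K R : Type*} [Field K] [CommRing R] [Algebra K R] {I J : Ideal R}
    (h : I ≤ J) : Module.length K (R ⧸ J) ≤ Module.length K (R ⧸ I) :=
  Module.length_le_of_surjective ((Ideal.Quotient.factorₐ K h).toLinearMap)
    (Ideal.Quotient.factor_surjective h)

/-- Additivity along `0 → R/(b, g) → R/(pb, g) → R/(p, g) → 0`, the first map being multiplication
by `p`. It is injective because `p` is prime and does not divide `g`. -/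
theorem length_quotient_span_mul {K R : Type*} [Field K] [CommRing R] [IsDomain R] [Algebra K R]
    {p g : R} (hp : Prime p) (hg : ¬ p ∣ g) (b : R) :
    Module.length K (R ⧸ Ideal.span {p * b, g}) =
      Module.length K (R ⧸ Ideal.span {p, g}) + Module.length K (R ⧸ Ideal.span {b, g}) := by
  have h1 : Ideal.span {p * b, g} ≤ Ideal.span {p, g} := by
    rw [Ideal.span_le]
    rintro x (rfl | rfl)
    · exact Ideal.mul_mem_right _ _ (Ideal.subset_span (by simp))
    · exact Ideal.subset_span (by simp)
  let f : (R ⧸ Ideal.span {b, g}) →ₗ[R] (R ⧸ Ideal.span {p * b, g}) :=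
    Submodule.mapQ _ _ (LinearMap.mulLeft R p) (by
      intro x hx
      obtain ⟨u, v, rfl⟩ := Ideal.mem_span_pair.1 hx
      refine Ideal.mem_span_pair.2 ⟨u, p * v, ?_⟩
      simp only [LinearMap.mulLeft_apply]
      ring)
  let q : (R ⧸ Ideal.span {p * b, g}) →ₗ[R] (R ⧸ Ideal.span {p, g}) :=
    Submodule.mapQ _ _ LinearMap.id h1
  have hf (x : R) : f (Ideal.Quotient.mk _ x) = Ideal.Quotient.mk _ (p * x) := rfl
  have hq (x : R) : q (Ideal.Quotient.mk _ x) = Ideal.Quotient.mk _ x := rfl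
  rw [add_comm]
  refine Module.length_eq_add_of_exact (f.restrictScalars K) (q.restrictScalars K) ?_ ?_ ?_
  · refine (injective_iff_map_eq_zero (f.restrictScalars K)).2 fun x hx => ?_
    obtain ⟨x, rfl⟩ := Ideal.Quotient.mk_surjective x
    rw [LinearMap.restrictScalars_apply, hf, Ideal.Quotient.eq_zero_iff_mem] at hx
    obtain ⟨u, v, huv⟩ := Ideal.mem_span_pair.1 hx
    have hv : p ∣ v * g := ⟨x - u * b, by linear_combination huv⟩
    obtain ⟨w, rfl⟩ := (hp.dvd_or_dvd hv).resolve_right hg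
    refine Ideal.Quotient.eq_zero_iff_mem.2 (Ideal.mem_span_pair.2 ⟨u, w, ?_⟩)
    exact mul_left_cancel₀ hp.ne_zero (by linear_combination huv)
  · intro x
    obtain ⟨x, rfl⟩ := Ideal.Quotient.mk_surjective x
    exact ⟨Ideal.Quotient.mk _ x, hq x⟩
  · intro x
    obtain ⟨x, rfl⟩ := Ideal.Quotient.mk_surjective x
    rw [LinearMap.restrictScalars_apply, hq, Ideal.Quotient.eq_zero_iff_mem]
    constructor
    · intro hx
      obtain ⟨u, v, rfl⟩ := Ideal.mem_span_pair.1 hx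
      refine ⟨Ideal.Quotient.mk _ u, ?_⟩
      rw [LinearMap.restrictScalars_apply, hf, Ideal.Quotient.eq]
      exact Ideal.mem_span_pair.2 ⟨0, -v, by ring⟩
    · rintro ⟨y, hy⟩
      obtain ⟨y, rfl⟩ := Ideal.Quotient.mk_surjective y
      rw [LinearMap.restrictScalars_apply, hf, Ideal.Quotient.eq] at hy
      have := h1 hy
      have h2 : p * y ∈ Ideal.span {p, g} :=
        Ideal.mul_mem_right _ _ (Ideal.subset_span (by simp))
      have h3 := Ideal.sub_mem _ h2 this
      rwa [sub_sub_cancel] at h3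

variable {K : Type*} [Field K]

theorem length_powerSeries_quotient_X_pow (n : ℕ) :
    Module.length K (PowerSeries K ⧸ Ideal.span {(PowerSeries.X : PowerSeries K) ^ n}) = n := by
  rw [length_quotient_of_surjective (M := Fin n → K) _
    (LinearMap.pi fun i : Fin n => PowerSeries.coeff (R := K) i)]
  · simp [Module.length_eq_finrank]
  · intro a
    refine ⟨PowerSeries.mk fun i => if h : i < n then a ⟨i, h⟩ else 0, ?_⟩
    ext i
    simp
  · intro x
    rw [Ideal.mem_span_singleton, PowerSeries.X_pow_dvd_iff, funext_iff]
    exact ⟨fun h m hm => h ⟨m, hm⟩, fun h i => h i i.2⟩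

theorem length_powerSeries_quotient (p : PowerSeries K) :
    Module.length K (PowerSeries K ⧸ Ideal.span {p}) = p.order := by
  by_cases hp : p = 0
  · subst hp
    rw [PowerSeries.order_zero, ENat.eq_top_iff_forall_ge]
    intro n
    rw [← length_powerSeries_quotient_X_pow (K := K) n]
    exact length_quotient_anti (by simp)
  · have h : Ideal.span {p} = Ideal.span {(PowerSeries.X : PowerSeries K) ^ p.order.toNat} := by
      conv_lhs => rw [← PowerSeries.X_pow_order_mul_divXPowOrder (f := p)]
      exact Ideal.span_singleton_mul_right_unit (PowerSeries.isUnit_divided_by_X_pow_order hp) _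
    rw [h, length_powerSeries_quotient_X_pow]
    exact PowerSeries.coe_toNat_order hp

instance : IsDomain (MvPowerSeries (Fin 2) K) := NoZeroDivisors.to_isDomain _

theorem prime_linearFactor (c : PowerSeries K) (hc : PowerSeries.constantCoeff c = 0) :
    Prime (linearFactor c) := by
  refine ⟨linearFactor_ne_zero c, ?_, fun a b hab => ?_⟩
  · intro h
    have := (h.map (evalAt c hc)).ne_zero
    rw [evalAt_linearFactor, sub_self] at this
    exact this rfl
  · simp only [linearFactor_dvd_iff c hc, map_mul, mul_eq_zero] at hab ⊢
    exact hab

/-- Setting `y = c(x)` identifies `K⟦x, y⟧/(y - c)` with `K⟦t⟧`, where a quotient by one element has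
dimension its order, infinite for `0`. -/
theorem length_quotient_linearFactor (c : PowerSeries K) (hc : PowerSeries.constantCoeff c = 0)
    (g : MvPowerSeries (Fin 2) K) :
    Module.length K (MvPowerSeries (Fin 2) K ⧸ Ideal.span {linearFactor c, g}) =
      (evalAt c hc g).order := by
  rw [← length_powerSeries_quotient]
  refine length_quotient_of_surjective _
    ((Ideal.Quotient.mkₐ K (Ideal.span {evalAt c hc g})).comp (evalAt c hc)).toLinearMap ?_ ?_
  · exact (Ideal.Quotient.mkₐ_surjective K _).comp (evalAt_surjective c hc)
  · intro x
    change Ideal.Quotient.mk _ (evalAt c hc x) = 0 ↔ _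
    rw [Ideal.Quotient.eq_zero_iff_mem, Ideal.mem_span_singleton, Ideal.mem_span_pair]
    constructor
    · rintro ⟨r, hr⟩
      obtain ⟨v, rfl⟩ := evalAt_surjective c hc r
      obtain ⟨u, hu⟩ := (linearFactor_dvd_iff c hc (x - g * v)).2 (by simp [hr])
      exact ⟨u, v, by linear_combination -hu⟩
    · rintro ⟨u, v, rfl⟩
      rw [map_add, map_mul, map_mul, evalAt_linearFactor, sub_self, mul_zero, zero_add]
      exact dvd_mul_left _ _

/-- Factors are removed one at a time by additivity. A factor dividing `g` escapes that argument,
but then both sides are infinite. -/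
theorem length_quotient_prod_linearFactor {ι : Type*} (s : Finset ι) (c : ι → PowerSeries K)
    (hc : ∀ i, PowerSeries.constantCoeff (c i) = 0) (g : MvPowerSeries (Fin 2) K) :
    Module.length K (MvPowerSeries (Fin 2) K ⧸ Ideal.span {∏ i ∈ s, linearFactor (c i), g}) =
      ∑ i ∈ s, (evalAt (c i) (hc i) g).order := by
  classical
  induction s using Finset.induction_on with
  | empty =>
    rw [Finset.prod_empty, Finset.sum_empty, Module.length_eq_zero_iff,
      Ideal.Quotient.subsingleton_iff, Ideal.eq_top_iff_one]
    exact Ideal.subset_span (by simp)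
  | insert i s hi ih =>
    rw [Finset.prod_insert hi, Finset.sum_insert hi]
    by_cases hg : linearFactor (c i) ∣ g
    · have h0 := (linearFactor_dvd_iff _ (hc i) _).1 hg
      have h1 := length_quotient_linearFactor (c i) (hc i) g
      rw [h0, PowerSeries.order_zero] at h1
      rw [h0, PowerSeries.order_zero, top_add, eq_top_iff, ← h1]
      refine length_quotient_anti ?_
      rw [Ideal.span_le]
      rintro x (rfl | rfl)
      · exact Ideal.mul_mem_right _ _ (Ideal.subset_span (by simp))
      · exact Ideal.subset_span (by simp)
    · rw [length_quotient_span_mul (prime_linearFactor _ (hc i)) hg, ih,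
        length_quotient_linearFactor]

theorem coeff_X_pow_mul_expo (i k j : ℕ) (f : MvPowerSeries (Fin 2) K) :
    coeff (expo k j) (X 0 ^ i * f) = if i ≤ k then coeff (expo (k - i) j) f else 0 := by
  have h : Finsupp.single 0 i ≤ expo k j ↔ i ≤ k := by
    simp
  have h' : expo k j - Finsupp.single 0 i = expo (k - i) j := by
    ext s; fin_cases s <;> simp
  rw [X_pow_eq, coeff_monomial_mul, h', one_mul]
  simp only [h]

/-- The map `(aᵢ) ↦ ∑ tⁱ aᵢ(t ^ N, y)`. -/
noncomputable def ramifySum {N : ℕ} (hN : N ≠ 0) :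
    (Fin N → MvPowerSeries (Fin 2) K) →ₗ[K] MvPowerSeries (Fin 2) K :=
  ∑ i : Fin N, (LinearMap.mulLeft K (X 0 ^ (i : ℕ))) ∘ₗ (ramify hN).toLinearMap ∘ₗ LinearMap.proj i

theorem ramifySum_apply {N : ℕ} (hN : N ≠ 0) (a : Fin N → MvPowerSeries (Fin 2) K) :
    ramifySum hN a = ∑ i : Fin N, X 0 ^ (i : ℕ) * ramify hN (a i) := by
  simp [ramifySum]

theorem coeff_ramifySum {N : ℕ} (hN : N ≠ 0) (a : Fin N → MvPowerSeries (Fin 2) K) (q : ℕ)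
    (r : Fin N) (j : ℕ) :
    coeff (expo (N * q + r) j) (ramifySum hN a) = coeff (expo q j) (a r) := by
  rw [ramifySum_apply, map_sum, Finset.sum_eq_single r]
  · rw [coeff_X_pow_mul_expo, if_pos (by omega), Nat.add_sub_cancel, coeff_mul_expo]
  · intro i _ hi
    rw [coeff_X_pow_mul_expo]
    split_ifs with h
    · rw [coeff_ramify, if_neg]
      intro hd
      apply hi
      have h1 : N ∣ (i : ℕ) + (N * q + r - i) - i := by simpa using hd
      have h2 : (N * q + r) ≡ i [MOD N] := ((Nat.modEq_iff_dvd' h).2 hd).symm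
      have h3 : (r : ℕ) % N = i % N := by
        have := h2
        rw [Nat.ModEq, Nat.mul_add_mod] at this
        exact this
      rw [Nat.mod_eq_of_lt r.2, Nat.mod_eq_of_lt i.2] at h3
      exact Fin.ext h3.symm
    · rfl
  · simp

/-- The series `1, t, …, t ^ (N - 1)` form a basis of `K⟦t, y⟧` over `K⟦t ^ N, y⟧`: Euclidean
division of the exponent of `t` by `N` sorts the monomials. -/
theorem ramifySum_bijective {N : ℕ} (hN : N ≠ 0) :
    Function.Bijective (ramifySum (K := K) hN) := by
  constructor
  · intro a b hab
    funext r
    refine ext_expo fun q j => ?_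
    rw [← coeff_ramifySum hN, hab, coeff_ramifySum]
  · intro f
    refine ⟨fun r => ofExpo fun q j => coeff (expo (N * q + r) j) f, ext_expo fun i j => ?_⟩
    have h := coeff_ramifySum hN (fun r => ofExpo fun q j => coeff (expo (N * q + r) j) f) (i / N)
      ⟨i % N, Nat.mod_lt _ (Nat.pos_of_ne_zero hN)⟩ j
    simpa [Nat.div_add_mod] using h

theorem mul_ramifySum {N : ℕ} (hN : N ≠ 0) (f : MvPowerSeries (Fin 2) K)
    (a : Fin N → MvPowerSeries (Fin 2) K) :
    ramifySum hN a * ramify hN f = ramifySum hN (fun i => a i * f) := by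
  rw [ramifySum_apply, ramifySum_apply, Finset.sum_mul]
  exact Finset.sum_congr rfl fun i _ => by rw [map_mul, mul_assoc]

/-- In the basis `1, t, …, t ^ (N - 1)` the ideal generated by the ramified `f` and `g` is `(f, g)`
in each coordinate, so the quotient is `N` copies of the original one. -/
theorem length_quotient_ramify {N : ℕ} (hN : N ≠ 0) (f g : MvPowerSeries (Fin 2) K) :
    Module.length K (MvPowerSeries (Fin 2) K ⧸ Ideal.span {ramify hN f, ramify hN g}) =
      N * Module.length K (MvPowerSeries (Fin 2) K ⧸ Ideal.span {f, g}) := by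
  let e := LinearEquiv.ofBijective _ (ramifySum_bijective (K := K) hN)
  have he (a) : e a = ramifySum hN a := rfl
  let q : (Fin N → MvPowerSeries (Fin 2) K) →ₗ[K]
      (Fin N → MvPowerSeries (Fin 2) K ⧸ Ideal.span {f, g}) :=
    LinearMap.pi fun i => (Ideal.Quotient.mkₐ K (Ideal.span {f, g})).toLinearMap ∘ₗ LinearMap.proj i
  have hq (a i) : q a i = Ideal.Quotient.mk _ (a i) := rfl
  have hs : Function.Surjective q := fun b => by
    choose a ha using fun i => Ideal.Quotient.mk_surjective (b i)
    exact ⟨a, funext fun i => (hq a i).trans (ha i)⟩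
  rw [length_quotient_of_surjective _ (q ∘ₗ e.symm.toLinearMap) (hs.comp e.symm.surjective)]
  · rw [Module.length_pi_of_fintype]
    simp
  · intro x
    obtain ⟨a, rfl⟩ := e.surjective x
    rw [LinearMap.comp_apply, LinearEquiv.coe_coe, e.symm_apply_apply, funext_iff,
      Ideal.mem_span_pair]
    simp only [hq, Pi.zero_apply, Ideal.Quotient.eq_zero_iff_mem, Ideal.mem_span_pair]
    constructor
    · intro h
      choose u v h using h
      refine ⟨ramifySum hN u, ramifySum hN v, ?_⟩
      rw [mul_ramifySum, mul_ramifySum, ← map_add, he]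
      congr 1
      exact funext h
    · rintro ⟨x, y, h⟩ i
      obtain ⟨u, rfl⟩ := e.surjective x
      obtain ⟨v, rfl⟩ := e.surjective y
      rw [he, he, mul_ramifySum, mul_ramifySum, ← map_add, ← he] at h
      exact ⟨u i, v i, congrFun (e.injective h) i⟩

theorem length_quotient_eq_sum {ι : Type*} (s : Finset ι) {N : ℕ} (hN : N ≠ 0)
    (f g u : MvPowerSeries (Fin 2) K) (hu : IsUnit u) (c : ι → PowerSeries K)
    (hc : ∀ i, PowerSeries.constantCoeff (c i) = 0)
    (hf : ramify hN f = u * ∏ i ∈ s, linearFactor (c i)) :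
    N * Module.length K (MvPowerSeries (Fin 2) K ⧸ Ideal.span {f, g}) =
      ∑ i ∈ s, (evalAt (c i) (hc i) (ramify hN g)).order := by
  rw [← length_quotient_ramify hN, ← length_quotient_prod_linearFactor, hf]
  rw [Ideal.span_insert, Ideal.span_singleton_mul_left_unit hu, ← Ideal.span_insert]

end Length

/-! ### Lengths over local rings and their completions -/

section LocalRings

/-- With `𝔪` the maximal ideal, either the chain `I + 𝔪 ^ n` stops decreasing at some step, and
Nakayama's lemma gives `𝔪 ^ n ≤ I`, or it decreases strictly forever and both sides are infinite.
The length thus depends only on the Artinian truncations. -/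
theorem length_quotient_eq_iSup {O : Type*} [CommRing O] [IsLocalRing O] [IsNoetherianRing O]
    (I : Ideal O) : Module.length O (O ⧸ I) =
      ⨆ n : ℕ, Module.length O (O ⧸ (I ⊔ IsLocalRing.maximalIdeal O ^ n)) := by
  simp only [Module.length_quotient]
  refine le_antisymm ?_ (iSup_le fun n => Order.coheight_anti le_sup_left)
  set J : ℕ → Ideal O := fun n => I ⊔ IsLocalRing.maximalIdeal O ^ n with hJ
  by_cases h : ∃ n, J n ≤ J (n + 1)
  · obtain ⟨n, hn⟩ := h
    have h1 : IsLocalRing.maximalIdeal O ^ n ≤ I := by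
      refine Submodule.le_of_le_smul_of_le_jacobson_bot (I := IsLocalRing.maximalIdeal O)
        (IsNoetherian.noetherian _) (IsLocalRing.maximalIdeal_le_jacobson _) ?_
      rw [smul_eq_mul, ← pow_succ']
      exact le_sup_right.trans hn
    have h2 : J n = I := sup_eq_left.2 h1
    exact (le_of_eq (by rw [h2])).trans (le_iSup (fun n => Order.coheight (J n)) n)
  · push Not at h
    have hlt (n : ℕ) : J (n + 1) < J n :=
      lt_of_le_not_ge (sup_le_sup_left (Ideal.pow_le_pow_right (Nat.le_succ n)) _) (h n)
    have hge (n : ℕ) : (n : ℕ∞) ≤ Order.coheight (J n) := by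
      induction n with
      | zero => simp
      | succ n ih =>
        push_cast
        exact (add_le_add_left ih 1).trans (Order.coheight_add_one_le (hlt n))
    have : ⨆ n, Order.coheight (J n) = ⊤ :=
      ENat.eq_top_iff_forall_ge.2 fun n => (hge n).trans (le_iSup (fun n => Order.coheight (J n)) n)
    rw [this]
    exact le_top

theorem length_quotient_eq_of_surjective {O R : Type*} [CommRing O] [CommRing R] (φ : O →+* R)
    (I : Ideal O) (J : Ideal R) (hs : ∀ r, ∃ o, r - φ o ∈ J) (hk : ∀ o, φ o ∈ J ↔ o ∈ I) :
    Module.length O (O ⧸ I) = Module.length R (R ⧸ J) := by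
  let f : O →+* R ⧸ J := (Ideal.Quotient.mk J).comp φ
  let : Algebra O (R ⧸ J) := f.toAlgebra
  have hf : Function.Surjective f := fun x => by
    obtain ⟨r, rfl⟩ := Ideal.Quotient.mk_surjective x
    obtain ⟨o, ho⟩ := hs r
    exact ⟨o, ((Ideal.Quotient.eq).2 ho).symm⟩
  have hker : LinearMap.ker (Algebra.linearMap O (R ⧸ J)) = I := by
    ext o
    rw [LinearMap.mem_ker, ← hk]
    exact Ideal.Quotient.eq_zero_iff_mem
  have e := (LinearMap.quotKerEquivOfSurjective (Algebra.linearMap O (R ⧸ J)) hf).length_eq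
  rw [hker] at e
  rw [e, Module.length_eq_of_surjective (S := O) (R := R ⧸ J) (M := R ⧸ J) hf]
  exact (Module.length_eq_of_surjective (S := R) (R := R ⧸ J) (M := R ⧸ J)
    Ideal.Quotient.mk_surjective).symm

/-- The hypotheses say that `φ` is an isomorphism modulo every power of the maximal ideals, as for a
completion. The two lengths then agree at each truncation, hence in the supremum. -/
theorem length_quotient_eq_of_dense {O R : Type*} [CommRing O] [IsLocalRing O] [IsNoetherianRing O]
    [CommRing R] [IsLocalRing R] [IsNoetherianRing R] (φ : O →+* R)
    (h1 : ∀ x ∈ IsLocalRing.maximalIdeal O, φ x ∈ IsLocalRing.maximalIdeal R)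
    (h2 : ∀ (n : ℕ) (r : R), ∃ o, r - φ o ∈ IsLocalRing.maximalIdeal R ^ n)
    (h3 : ∀ (n : ℕ) (o : O), φ o ∈ IsLocalRing.maximalIdeal R ^ n →
      o ∈ IsLocalRing.maximalIdeal O ^ n) (I : Ideal O) :
    Module.length O (O ⧸ I) = Module.length R (R ⧸ I.map φ) := by
  rw [length_quotient_eq_iSup I, length_quotient_eq_iSup (I.map φ)]
  refine iSup_congr fun n => length_quotient_eq_of_surjective φ _ _ (fun r => ?_) (fun o => ?_)
  · obtain ⟨o, ho⟩ := h2 n r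
    exact ⟨o, Ideal.mem_sup_right ho⟩
  · constructor
    · intro h
      obtain ⟨a, ha, b, hb, hab⟩ := Submodule.mem_sup.1 h
      have key : ∃ i ∈ I, a - φ i ∈ IsLocalRing.maximalIdeal R ^ n := by
        refine Submodule.span_induction (p := fun a _ => ∃ i ∈ I,
          a - φ i ∈ IsLocalRing.maximalIdeal R ^ n) ?_ ?_ ?_ ?_ ha
        · rintro _ ⟨i, hi, rfl⟩
          exact ⟨i, hi, by simp⟩
        · exact ⟨0, I.zero_mem, by simp⟩
        · rintro x y - - ⟨i, hi, hx⟩ ⟨j, hj, hy⟩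
          refine ⟨i + j, I.add_mem hi hj, ?_⟩
          rw [map_add, add_sub_add_comm]
          exact Ideal.add_mem _ hx hy
        · rintro r x - ⟨i, hi, hx⟩
          obtain ⟨o, ho⟩ := h2 n r
          refine ⟨o * i, I.mul_mem_left _ hi, ?_⟩
          have : r • x - φ (o * i) = r * (x - φ i) + φ i * (r - φ o) := by
            rw [map_mul, smul_eq_mul]; ring
          rw [this]
          exact Ideal.add_mem _ (Ideal.mul_mem_left _ _ hx) (Ideal.mul_mem_left _ _ ho)
      obtain ⟨i, hi, hai⟩ := key
      have : φ (o - i) ∈ IsLocalRing.maximalIdeal R ^ n := by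
        rw [map_sub, ← hab, add_sub_right_comm]
        exact Ideal.add_mem _ hai hb
      rw [← add_sub_cancel i o]
      exact Ideal.add_mem _ (Ideal.mem_sup_left hi) (Ideal.mem_sup_right (h3 n _ this))
    · intro h
      have : I ⊔ IsLocalRing.maximalIdeal O ^ n ≤
          (I.map φ ⊔ IsLocalRing.maximalIdeal R ^ n).comap φ := by
        refine sup_le (Ideal.map_le_iff_le_comap.1 le_sup_left) ?_
        rw [← Ideal.map_le_iff_le_comap, Ideal.map_pow]
        exact (Ideal.pow_right_mono (Ideal.map_le_iff_le_comap.2 h1) n).trans le_sup_right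
      exact this h

/-- Each simple quotient in a composition series is the residue field, which by `hr` is
one-dimensional over `K`. -/
theorem length_eq_length_of_isFiniteLength {K R : Type*} [Field K] [CommRing R] [IsLocalRing R]
    [Algebra K R] (hr : ∀ r : R, ∃ k : K, r - algebraMap K R k ∈ IsLocalRing.maximalIdeal R)
    {M : Type*} [AddCommGroup M] [Module R M] (hM : IsFiniteLength R M) :
    ∀ [Module K M] [IsScalarTower K R M], Module.length R M = Module.length K M := by
  induction hM with
  | of_subsingleton =>
    intros
    rw [Module.length_eq_zero, Module.length_eq_zero]
  | @of_simple_quotient M _ _ N hS hN ih =>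
    intros
    have e1 := Module.length_eq_add_of_exact N.subtype N.mkQ N.injective_subtype N.mkQ_surjective
      (LinearMap.exact_subtype_mkQ N)
    have e2 := Module.length_eq_add_of_exact (N.subtype.restrictScalars K)
      (N.mkQ.restrictScalars K) N.injective_subtype N.mkQ_surjective
      (LinearMap.exact_subtype_mkQ N)
    rw [e1, e2, ih, Module.length_eq_one R (M ⧸ N)]
    congr 1
    obtain ⟨m, hm, ⟨e⟩⟩ := isSimpleModule_iff_quot_maximal.1 hS
    rw [(e.restrictScalars K).length_eq]
    obtain rfl := IsLocalRing.eq_maximalIdeal hm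
    have hb : Function.Bijective (Algebra.linearMap K (R ⧸ IsLocalRing.maximalIdeal R)) := by
      constructor
      · exact (algebraMap K (R ⧸ IsLocalRing.maximalIdeal R)).injective
      · intro x
        obtain ⟨r, rfl⟩ := Ideal.Quotient.mk_surjective x
        obtain ⟨k, hk⟩ := hr r
        exact ⟨k, ((Ideal.Quotient.eq).2 hk).symm⟩
    rw [← (LinearEquiv.ofBijective _ hb).length_eq, Module.length_eq_one]

theorem length_eq_length_of_residue {K R : Type*} [Field K] [CommRing R] [IsLocalRing R]
    [Algebra K R] (hr : ∀ r : R, ∃ k : K, r - algebraMap K R k ∈ IsLocalRing.maximalIdeal R)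
    (M : Type*) [AddCommGroup M] [Module R M] [Module K M] [IsScalarTower K R M] :
    Module.length R M = Module.length K M := by
  by_cases hM : IsFiniteLength R M
  · exact length_eq_length_of_isFiniteLength hr hM
  · have h := Submodule.length_le_length_restrictScalars (R := R) K (⊤ : Submodule R M)
    rw [Module.length_top, Submodule.restrictScalars_top, Module.length_top] at h
    rw [← Module.length_ne_top_iff, not_not] at hM
    rw [hM] at h ⊢
    exact (top_le_iff.1 h).symm

end LocalRings

/-! ### Powers of the maximal ideal of `K⟦x, y⟧` -/

section MaximalIdeal

variable {K : Type*} [Field K]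

theorem mem_maximalIdeal_iff (f : MvPowerSeries (Fin 2) K) :
    f ∈ IsLocalRing.maximalIdeal (MvPowerSeries (Fin 2) K) ↔ constantCoeff f = 0 := by
  rw [IsLocalRing.mem_maximalIdeal, mem_nonunits_iff, isUnit_iff_constantCoeff, isUnit_iff_ne_zero,
    not_not]

theorem le_order_of_mem_maximalIdeal_pow {n : ℕ} {f : MvPowerSeries (Fin 2) K}
    (hf : f ∈ IsLocalRing.maximalIdeal (MvPowerSeries (Fin 2) K) ^ n) :
    (n : ℕ∞) ≤ f.order := by
  induction n generalizing f with
  | zero => simp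
  | succ n ih =>
    rw [pow_succ] at hf
    refine Submodule.mul_induction_on hf (fun a ha b hb => ?_) (fun a b ha hb => ?_)
    · rw [order_mul, Nat.cast_add, Nat.cast_one]
      exact add_le_add (ih ha) (one_le_order_iff_constCoeff_eq_zero.2 ((mem_maximalIdeal_iff b).1 hb))
    · exact (le_min ha hb).trans min_order_le_add

/-- Induction on `n`: the monomials divisible by `x` are collected in `x a`, the remaining pure
powers of `y` in `y b`, and `a`, `b` lie one power lower. -/
theorem mem_maximalIdeal_pow {n : ℕ} {f : MvPowerSeries (Fin 2) K}
    (hf : ∀ i j, i + j < n → coeff (expo i j) f = 0) :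
    f ∈ IsLocalRing.maximalIdeal (MvPowerSeries (Fin 2) K) ^ n := by
  induction n generalizing f with
  | zero => simp
  | succ n ih =>
    have h : f = X 0 * ofExpo (fun i j => coeff (expo (i + 1) j) f) +
        X 1 * ofExpo (fun i j => if i = 0 then coeff (expo 0 (j + 1)) f else 0) := by
      refine ext_expo fun i j => ?_
      have h0 : coeff (expo i j) (X 0 * ofExpo (fun i j => coeff (expo (i + 1) j) f)) =
          if 1 ≤ i then coeff (expo i j) f else 0 := by
        have := coeff_X_pow_mul_expo 1 i j (ofExpo (fun i j => coeff (expo (i + 1) j) f))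
        rw [pow_one] at this
        rw [this, coeff_ofExpo]
        split_ifs with hi
        · rw [Nat.sub_add_cancel hi]
        · rfl
      have h1 : coeff (expo i j) (X 1 * ofExpo (fun i j => if i = 0 then coeff (expo 0 (j + 1)) f
          else 0)) = if 1 ≤ j ∧ i = 0 then coeff (expo i j) f else 0 := by
        have h : Finsupp.single 1 1 ≤ expo i j ↔ 1 ≤ j := by simp
        have h' : expo i j - Finsupp.single 1 1 = expo i (j - 1) := by
          ext s; fin_cases s <;> simp
        rw [MvPowerSeries.X, coeff_monomial_mul, h', one_mul, coeff_ofExpo]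
        simp only [h]
        by_cases a : 1 ≤ j
        · by_cases b : i = 0 <;> simp [a, b, Nat.sub_add_cancel a]
        · simp [a]
      rw [map_add, h0, h1]
      rcases Nat.eq_zero_or_pos i with rfl | hi
      · rcases Nat.eq_zero_or_pos j with rfl | hj
        · simp [hf 0 0 (by omega)]
        · simp [Nat.one_le_iff_ne_zero.2 hj.ne']
      · simp [Nat.one_le_iff_ne_zero.2 hi.ne', hi.ne']
    rw [h, pow_succ']
    refine Ideal.add_mem _ (Ideal.mul_mem_mul ?_ (ih ?_)) (Ideal.mul_mem_mul ?_ (ih ?_))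
    · rw [mem_maximalIdeal_iff, constantCoeff_X]
    · intro i j hij
      rw [coeff_ofExpo]
      exact hf _ _ (by omega)
    · rw [mem_maximalIdeal_iff, constantCoeff_X]
    · intro i j hij
      rw [coeff_ofExpo]
      split_ifs
      · exact hf _ _ (by omega)
      · rfl

theorem length_quotient_eq_length_field (J : Ideal (MvPowerSeries (Fin 2) K)) :
    Module.length (MvPowerSeries (Fin 2) K) (MvPowerSeries (Fin 2) K ⧸ J) =
      Module.length K (MvPowerSeries (Fin 2) K ⧸ J) :=
  length_eq_length_of_residue (fun r => ⟨constantCoeff r, by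
    rw [mem_maximalIdeal_iff, map_sub, ← c_eq_algebraMap, constantCoeff_C, sub_self]⟩) _

end MaximalIdeal

/-! ### The local ring of a point of the plane and its completion `ℂ(z)⟦x, y⟧` -/

section Localization

theorem aeval_smul_of_isHomogeneous {A : Type*} [CommRing A] [Algebra ℂ A] {σ : Type*}
    {G : MvPolynomial σ ℂ} {d : ℕ} (hG : G.IsHomogeneous d) (z : A) (w : σ → A) :
    MvPolynomial.aeval (fun i => z * w i) G = z ^ d * MvPolynomial.aeval w G := by
  rw [MvPolynomial.aeval_def, MvPolynomial.eval₂_eq, MvPolynomial.aeval_def,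
    MvPolynomial.eval₂_eq, Finset.mul_sum]
  refine Finset.sum_congr rfl fun n hn => ?_
  have h : n.degree = d := by
    rw [Finsupp.degree_eq_weight_one]
    exact hG (MvPolynomial.mem_support_iff.1 hn)
  simp only [mul_pow, Finset.prod_mul_distrib, Finset.prod_pow_eq_pow_sum]
  rw [← h, Finsupp.degree_apply]
  ring

theorem comp_comp (F : MvPolynomial (Fin 3) ℂ) (M N : GL (Fin 3) ℂ) :
    comp (comp F M) N = comp F (M * N) := by
  unfold comp
  rw [MvPolynomial.bind₁_bind₁]
  congr 2
  funext i
  simp only [map_sum, map_mul, MvPolynomial.bind₁_X_right, MvPolynomial.algHom_C,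
    MvPolynomial.algebraMap_eq, Units.val_mul, Matrix.mul_apply]
  simp only [Finset.mul_sum, Finset.sum_mul]
  rw [Finset.sum_comm]
  simp only [mul_assoc]

theorem comp_one (F : MvPolynomial (Fin 3) ℂ) : comp F 1 = F := by
  have : (fun i => ∑ j, MvPolynomial.C (((1 : GL (Fin 3) ℂ) : Matrix _ _ ℂ) i j) *
      MvPolynomial.X j : Fin 3 → MvPolynomial (Fin 3) ℂ) = MvPolynomial.X := by
    funext i
    simp [Matrix.one_apply]
  rw [comp, this, MvPolynomial.bind₁_X_left, AlgHom.id_apply]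

theorem isHomogeneous_comp {F : MvPolynomial (Fin 3) ℂ} {d : ℕ} (hF : F.IsHomogeneous d)
    (M : GL (Fin 3) ℂ) : (comp F M).IsHomogeneous d := by
  have := MvPolynomial.IsHomogeneous.aeval hF (n := 1)
    (fun i => ∑ j, MvPolynomial.C (M i j) * MvPolynomial.X j) (fun i =>
      MvPolynomial.IsHomogeneous.sum _ _ _ fun j _ => by
        simpa using (MvPolynomial.isHomogeneous_C _ _).mul (MvPolynomial.isHomogeneous_X _ _))
  rwa [one_mul] at this

/-- The coefficient field of the completed local ring of a point of the plane. -/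
abbrev ConeField : Type := RatFunc ℂ

/-- The completed local ring of a point of the plane. -/
abbrev CompletedRing : Type := MvPowerSeries (Fin 2) ConeField

/-- The map `P ↦ P(zx, zy, z)`. -/
noncomputable def coneMap : MvPolynomial (Fin 3) ℂ →ₐ[ℂ] CompletedRing :=
  MvPolynomial.aeval (fun i => C RatFunc.X * ![X 0, X 1, 1] i)

theorem coneMap_of_isHomogeneous {G : MvPolynomial (Fin 3) ℂ} {d : ℕ} (hG : G.IsHomogeneous d) :
    coneMap G = C RatFunc.X ^ d *
      map (algebraMap ℂ ConeField) (localEquation G : MvPowerSeries (Fin 2) ℂ) := by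
  rw [coneMap, aeval_smul_of_isHomogeneous hG]
  congr 1
  have h := MvPolynomial.coeToMvPowerSeries.algHom_apply (A := ConeField) (localEquation G)
  rw [← h, localEquation, ← AlgHom.comp_apply, MvPolynomial.comp_aeval]
  congr 2
  funext i
  fin_cases i <;> simp

theorem isUnit_coneVar (d : ℕ) : IsUnit (C (σ := Fin 2) (RatFunc.X : ConeField) ^ d) :=
  ((RatFunc.X_ne_zero.isUnit).map _).pow d

theorem coneMap_monomial (n : Fin 3 →₀ ℕ) (a : ℂ) :
    coneMap (MvPolynomial.monomial n a) =
      monomial (expo (n 0) (n 1)) (algebraMap (Polynomial ℂ) ConeField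
        (Polynomial.monomial (n 0 + n 1 + n 2) a)) := by
  have h : (monomial (expo (n 0) (n 1)) : ConeField →ₗ[ConeField] CompletedRing)
      (algebraMap (Polynomial ℂ) ConeField (Polynomial.monomial (n 0 + n 1 + n 2) a)) =
      C (algebraMap (Polynomial ℂ) ConeField (Polynomial.monomial (n 0 + n 1 + n 2) a)) *
        (X 0 ^ n 0 * X 1 ^ n 1) := by
    rw [X_pow_eq, X_pow_eq, monomial_mul_monomial, ← monomial_zero_eq_C_apply,
      monomial_mul_monomial, zero_add, mul_one, mul_one, expo]
  have hC : algebraMap (Polynomial ℂ) ConeField (Polynomial.C a) = algebraMap ℂ ConeField a := rfl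
  rw [h, coneMap, MvPolynomial.aeval_monomial, Finsupp.prod_fintype _ _ (by simp),
    Fin.prod_univ_three, ← Polynomial.C_mul_X_pow_eq_monomial, map_mul, map_pow, RatFunc.algebraMap_X,
    hC, MvPowerSeries.algebraMap_apply]
  simp only [Matrix.cons_val_zero, Matrix.cons_val_one, Matrix.cons_val, mul_one, map_mul, map_pow]
  ring

theorem coeff_coneMap (G : MvPolynomial (Fin 3) ℂ) (i j : ℕ) :
    coeff (expo i j) (coneMap G) = algebraMap (Polynomial ℂ) ConeField
      (∑ n ∈ G.support with n 0 = i ∧ n 1 = j,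
        Polynomial.monomial (n 0 + n 1 + n 2) (G.coeff n)) := by
  conv_lhs => rw [G.as_sum]
  rw [map_sum, map_sum, Finset.sum_filter, map_sum]
  refine Finset.sum_congr rfl fun n _ => ?_
  rw [coneMap_monomial, coeff_monomial]
  simp only [expo_inj, eq_comm (a := i), eq_comm (a := j), apply_ite (algebraMap _ _), map_zero]

/-- Distinct monomials do not interfere: `XⁱYʲZᵏ` becomes `z ^ (i + j + k) xⁱ yʲ`, from which all
three exponents can be read. -/
theorem coeff_eq_zero_of_coneMap {G : MvPolynomial (Fin 3) ℂ} {n : Fin 3 →₀ ℕ}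
    (h : coeff (expo (n 0) (n 1)) (coneMap G) = 0) : G.coeff n = 0 := by
  rw [coeff_coneMap, map_eq_zero_iff _ (RatFunc.algebraMap_injective ℂ)] at h
  have := congrArg (Polynomial.coeff · (n 0 + n 1 + n 2)) h
  simp only [Polynomial.finsetSum_coeff, Polynomial.coeff_monomial, Polynomial.coeff_zero] at this
  rw [Finset.sum_eq_single n] at this
  · simpa using this
  · intro k hk hkn
    rw [if_neg]
    intro h'
    obtain ⟨h0, h1⟩ := (Finset.mem_filter.1 hk).2
    apply hkn
    ext i
    fin_cases i
    · exact h0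
    · exact h1
    · simp only [Fin.reduceFinMk]
      omega
  · intro hn
    rw [if_pos rfl]
    simpa using hn

theorem mem_span_pow_of_coneMap {G : MvPolynomial (Fin 3) ℂ} {n : ℕ}
    (h : (n : ℕ∞) ≤ (coneMap G).order) :
    G ∈ Ideal.span {(MvPolynomial.X 0 : MvPolynomial (Fin 3) ℂ), MvPolynomial.X 1} ^ n := by
  rw [G.as_sum]
  refine Ideal.sum_mem _ fun k hk => ?_
  have hk' : n ≤ k 0 + k 1 := by
    by_contra hlt
    refine MvPolynomial.mem_support_iff.1 hk (coeff_eq_zero_of_coneMap (coeff_of_lt_order ?_))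
    refine lt_of_lt_of_le ?_ h
    rw [Finsupp.degree_eq_sum, Fin.sum_univ_two, expo_zero, expo_one]
    exact_mod_cast not_le.1 hlt
  rw [MvPolynomial.monomial_eq, Finsupp.prod_fintype _ _ (by simp), Fin.prod_univ_three]
  refine Ideal.mul_mem_left _ _ (Ideal.mul_mem_right _ _ (Ideal.pow_le_pow_right hk' ?_))
  rw [pow_add]
  exact Ideal.mul_mem_mul (Ideal.pow_mem_pow (Ideal.subset_span (by simp)) _)
    (Ideal.pow_mem_pow (Ideal.subset_span (by simp)) _)

/-- The map `P ↦ (P ∘ M)(zx, zy, z)`. -/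
noncomputable def conePointMap (M : GL (Fin 3) ℂ) : MvPolynomial (Fin 3) ℂ →+* CompletedRing :=
  (coneMap.comp (MvPolynomial.bind₁ (fun i => ∑ j, MvPolynomial.C (M i j) * MvPolynomial.X j))).toRingHom

theorem conePointMap_apply (M : GL (Fin 3) ℂ) (P : MvPolynomial (Fin 3) ℂ) :
    conePointMap M P = coneMap (comp P M) := rfl

theorem constantCoeff_coneMap (P : MvPolynomial (Fin 3) ℂ) :
    constantCoeff (coneMap P) = algebraMap (Polynomial ℂ) ConeField
      (MvPolynomial.aeval ![0, 0, Polynomial.X] P) := by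
  have h : ((constantCoeff (σ := Fin 2) (R := ConeField)).comp coneMap.toRingHom) =
      (algebraMap (Polynomial ℂ) ConeField).comp
        (MvPolynomial.aeval (![0, 0, Polynomial.X] : Fin 3 → Polynomial ℂ)).toRingHom := by
    refine MvPolynomial.ringHom_ext (fun a => ?_) (fun i => ?_)
    · simp [coneMap, MvPowerSeries.algebraMap_apply]
    · fin_cases i <;> simp [coneMap]
  exact DFunLike.congr_fun h P

/-- At `x = y = 0` the series becomes the restriction of `P` to the line spanned by the third column
of `M`. The chosen representative of the point differs from that column by a nonzero scalar,
absorbed in a rescaling of `z`. -/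
theorem mem_pointIdeal_iff (M : GL (Fin 3) ℂ) (P : MvPolynomial (Fin 3) ℂ) :
    P ∈ pointIdeal (imageOrigin M) ↔ constantCoeff (conePointMap M P) = 0 := by
  obtain ⟨a, ha⟩ := Projectivization.exists_smul_eq_mk_rep ℂ
    ((M : Matrix (Fin 3) (Fin 3) ℂ).mulVec ![0, 0, 1]) (mulVec_ne_zero M)
  have hv (i : Fin 3) : (M : Matrix (Fin 3) (Fin 3) ℂ).mulVec ![0, 0, 1] i = M i 2 := by
    simp [Matrix.mulVec, dotProduct, Fin.sum_univ_three]
  have hrep (i : Fin 3) : (imageOrigin M).rep i = a * M i 2 := by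
    rw [imageOrigin, ← ha, Pi.smul_apply, hv]
    rfl
  have h1 : MvPolynomial.aeval (![0, 0, Polynomial.X] : Fin 3 → Polynomial ℂ) (comp P M) =
      MvPolynomial.aeval (fun i => Polynomial.C (M i 2) * Polynomial.X : Fin 3 → Polynomial ℂ) P := by
    rw [comp, MvPolynomial.aeval_bind₁]
    congr 2
    funext i
    simp [Fin.sum_univ_three]
  have h2 : MvPolynomial.aeval
      (fun i => Polynomial.C ((imageOrigin M).rep i) * Polynomial.X : Fin 3 → Polynomial ℂ) P =
      (MvPolynomial.aeval
        (fun i => Polynomial.C (M i 2) * Polynomial.X : Fin 3 → Polynomial ℂ) P).comp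
        (Polynomial.C (a : ℂ) * Polynomial.X) := by
    rw [Polynomial.comp_eq_aeval, ← AlgHom.comp_apply, MvPolynomial.comp_aeval]
    congr 2
    funext i
    simp [hrep]
    ring
  rw [conePointMap_apply, constantCoeff_coneMap, map_eq_zero_iff _ (RatFunc.algebraMap_injective ℂ),
    h1, pointIdeal, RingHom.mem_ker]
  change MvPolynomial.aeval _ P = 0 ↔ _
  rw [h2, Polynomial.comp_C_mul_X_eq_zero_iff (mem_nonZeroDivisors_of_ne_zero a.ne_zero)]

theorem isUnit_conePointMap (M : GL (Fin 3) ℂ) (P : (pointIdeal (imageOrigin M)).primeCompl) :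
    IsUnit (conePointMap M P) := by
  rw [isUnit_iff_constantCoeff, isUnit_iff_ne_zero, Ne, ← mem_pointIdeal_iff]
  exact P.2

/-- The map from the local ring of a point of the plane to its completion. -/
noncomputable def localMap (M : GL (Fin 3) ℂ) :
    Localization.AtPrime (pointIdeal (imageOrigin M)) →+* CompletedRing :=
  IsLocalization.lift (M := (pointIdeal (imageOrigin M)).primeCompl) (isUnit_conePointMap M)

theorem localMap_algebraMap (M : GL (Fin 3) ℂ) (P : MvPolynomial (Fin 3) ℂ) :
    localMap M (algebraMap _ _ P) = conePointMap M P :=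
  IsLocalization.lift_eq _ _

theorem localMap_mem_maximalIdeal (M : GL (Fin 3) ℂ)
    (x : Localization.AtPrime (pointIdeal (imageOrigin M)))
    (hx : x ∈ IsLocalRing.maximalIdeal (Localization.AtPrime (pointIdeal (imageOrigin M)))) :
    localMap M x ∈ IsLocalRing.maximalIdeal CompletedRing := by
  rw [← Localization.AtPrime.map_eq_maximalIdeal] at hx
  refine (Ideal.map_le_iff_le_comap (K := (IsLocalRing.maximalIdeal CompletedRing).comap
    (localMap M))).2 (fun P hP => ?_) hx
  rw [Ideal.mem_comap, Ideal.mem_comap, localMap_algebraMap, mem_maximalIdeal_iff]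
  exact (mem_pointIdeal_iff M P).1 hP

theorem conePointMap_comp_inv (M : GL (Fin 3) ℂ) (P : MvPolynomial (Fin 3) ℂ) :
    conePointMap M (comp P M⁻¹) = coneMap P := by
  rw [conePointMap_apply, comp_comp, inv_mul_cancel, comp_one]

/-- In the coordinates given by `M` the order of the image bounds the degree in `X, Y` of every
monomial from below, so `P ∘ M` lies in `(X, Y) ^ n`. Composing with `M⁻¹` sends `X` and `Y` into
the ideal of the point. -/
theorem mem_pointIdeal_pow (M : GL (Fin 3) ℂ) (P : MvPolynomial (Fin 3) ℂ) (n : ℕ)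
    (h : conePointMap M P ∈ IsLocalRing.maximalIdeal CompletedRing ^ n) :
    P ∈ pointIdeal (imageOrigin M) ^ n := by
  have h1 := mem_span_pow_of_coneMap (le_order_of_mem_maximalIdeal_pow h)
  let f : MvPolynomial (Fin 3) ℂ →+* MvPolynomial (Fin 3) ℂ :=
    (MvPolynomial.bind₁ (fun i => ∑ j, MvPolynomial.C (M⁻¹ i j) * MvPolynomial.X j)).toRingHom
  have hf (Q : MvPolynomial (Fin 3) ℂ) : f Q = comp Q M⁻¹ := rfl
  have h2 := Ideal.mem_map_of_mem f h1
  change f (comp P M) ∈ _ at h2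
  rw [hf, comp_comp, mul_inv_cancel, comp_one, Ideal.map_pow] at h2
  refine Ideal.pow_right_mono (Ideal.map_le_iff_le_comap.2 (Ideal.span_le.2 ?_)) n h2
  rintro Q (rfl | rfl)
  · rw [SetLike.mem_coe, Ideal.mem_comap, mem_pointIdeal_iff, hf, conePointMap_comp_inv]
    simp [coneMap]
  · rw [SetLike.mem_coe, Ideal.mem_comap, mem_pointIdeal_iff, hf, conePointMap_comp_inv]
    simp [coneMap]

theorem mem_maximalIdeal_pow_of_localMap (M : GL (Fin 3) ℂ) (n : ℕ)
    (x : Localization.AtPrime (pointIdeal (imageOrigin M)))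
    (h : localMap M x ∈ IsLocalRing.maximalIdeal CompletedRing ^ n) :
    x ∈ IsLocalRing.maximalIdeal (Localization.AtPrime (pointIdeal (imageOrigin M))) ^ n := by
  obtain ⟨P, s, rfl⟩ := IsLocalization.exists_mk'_eq (pointIdeal (imageOrigin M)).primeCompl x
  have h1 : conePointMap M P ∈ IsLocalRing.maximalIdeal CompletedRing ^ n := by
    rw [← localMap_algebraMap, ← IsLocalization.mk'_spec _ P s, map_mul]
    exact Ideal.mul_mem_right _ _ h
  rw [IsLocalization.mk'_eq_mul_mk'_one, ← Localization.AtPrime.map_eq_maximalIdeal,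
    ← Ideal.map_pow]
  exact Ideal.mul_mem_right _ _ (Ideal.mem_map_of_mem _ (mem_pointIdeal_pow M P n h1))

/-- `localMap` sends nonunits to nonunits, so a preimage of a unit is itself invertible. This brings
the denominators of `ℂ(z)` into the range. -/
theorem inv_mem_range_localMap (M : GL (Fin 3) ℂ) {u v : CompletedRing} (huv : u * v = 1)
    (hu : u ∈ (localMap M).range) : v ∈ (localMap M).range := by
  obtain ⟨x, rfl⟩ := hu
  have hx : IsUnit x := by
    by_contra h
    have := localMap_mem_maximalIdeal M x ((IsLocalRing.mem_maximalIdeal x).2 h)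
    exact (IsLocalRing.mem_maximalIdeal _).1 this (IsUnit.of_mul_eq_one _ huv)
  obtain ⟨y, hy⟩ := hx.exists_right_inv
  refine ⟨y, ?_⟩
  have h1 : localMap M x * localMap M y = 1 := by rw [← map_mul, hy, map_one]
  calc localMap M y = (localMap M x * v) * localMap M y := by rw [huv, one_mul]
    _ = (localMap M x * localMap M y) * v := by ring
    _ = v := by rw [h1, one_mul]

theorem coneMap_mem_range_localMap (M : GL (Fin 3) ℂ) (P : MvPolynomial (Fin 3) ℂ) :
    coneMap P ∈ (localMap M).range :=
  ⟨algebraMap _ _ (comp P M⁻¹), by rw [localMap_algebraMap, conePointMap_comp_inv]⟩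

theorem C_algebraMap_mem_range_localMap (M : GL (Fin 3) ℂ) (p : Polynomial ℂ) :
    (C (algebraMap (Polynomial ℂ) ConeField p) : CompletedRing) ∈ (localMap M).range := by
  induction p using Polynomial.induction_on' with
  | add p q hp hq =>
    rw [map_add, map_add]
    exact add_mem hp hq
  | monomial n a =>
    have h := coneMap_mem_range_localMap M (MvPolynomial.monomial (Finsupp.single 2 n) a)
    rw [coneMap_monomial] at h
    simpa [expo] using h

theorem C_mem_range_localMap (M : GL (Fin 3) ℂ) (k : ConeField) :
    (C k : CompletedRing) ∈ (localMap M).range := by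
  obtain ⟨p, q, hq, rfl⟩ := IsFractionRing.div_surjective (A := Polynomial ℂ) k
  have hq0 : algebraMap (Polynomial ℂ) ConeField q ≠ 0 := by
    rw [Ne, map_eq_zero_iff _ (RatFunc.algebraMap_injective ℂ)]
    exact nonZeroDivisors.ne_zero hq
  rw [div_eq_mul_inv, map_mul]
  refine mul_mem (C_algebraMap_mem_range_localMap M p)
    (inv_mem_range_localMap M ?_ (C_algebraMap_mem_range_localMap M q))
  rw [← map_mul, mul_inv_cancel₀ hq0, map_one]

theorem X_mem_range_localMap (M : GL (Fin 3) ℂ) (i : Fin 2) :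
    (X i : CompletedRing) ∈ (localMap M).range := by
  have h : (X i : CompletedRing) = C (RatFunc.X : ConeField)⁻¹ *
      coneMap (MvPolynomial.X i.castSucc) := by
    have h1 : (C (RatFunc.X : ConeField)⁻¹ * C RatFunc.X : CompletedRing) = 1 := by
      rw [← map_mul, inv_mul_cancel₀ RatFunc.X_ne_zero, map_one]
    fin_cases i <;> simp [coneMap, ← mul_assoc, h1]
  rw [h]
  exact mul_mem (C_mem_range_localMap M _) (coneMap_mem_range_localMap M _)

/-- The range is a subring containing the constants `ℂ(z)` and the variables `x`, `y`, hence
polynomial truncations of every series. -/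
theorem localMap_dense (M : GL (Fin 3) ℂ) (n : ℕ) (r : CompletedRing) :
    ∃ x, r - localMap M x ∈ IsLocalRing.maximalIdeal CompletedRing ^ n := by
  have h : (∑ i ∈ Finset.range n, ∑ j ∈ Finset.range n,
      C (coeff (expo i j) r) * (X 0 ^ i * X 1 ^ j) : CompletedRing) ∈ (localMap M).range :=
    sum_mem fun i _ => sum_mem fun j _ => mul_mem (C_mem_range_localMap M _)
      (mul_mem (pow_mem (X_mem_range_localMap M 0) _) (pow_mem (X_mem_range_localMap M 1) _))
  obtain ⟨x, hx⟩ := h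
  refine ⟨x, mem_maximalIdeal_pow fun i j hij => ?_⟩
  have hC (a b : ℕ) : (C (coeff (expo a b) r) * (X 0 ^ a * X 1 ^ b) : CompletedRing) =
      monomial (expo a b) (coeff (expo a b) r) := by
    rw [X_pow_eq, X_pow_eq, monomial_mul_monomial, ← monomial_zero_eq_C_apply,
      monomial_mul_monomial, zero_add, mul_one, mul_one, expo]
  rw [map_sub, hx, sub_eq_zero, map_sum, Finset.sum_eq_single i, map_sum, Finset.sum_eq_single j]
  · rw [hC, coeff_monomial_same]
  · intro b _ hb
    rw [hC, coeff_monomial_ne]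
    exact fun h => hb (expo_inj.1 h).2.symm
  · intro h
    exact absurd (Finset.mem_range.2 (by omega)) h
  · intro a _ ha
    rw [map_sum]
    refine Finset.sum_eq_zero fun b _ => ?_
    rw [hC, coeff_monomial_ne]
    exact fun h => ha (expo_inj.1 h).1.symm
  · intro h
    exact absurd (Finset.mem_range.2 (by omega)) h

/-- After completion the length over the ring is the dimension over its residue field `ℂ(z)`, and
the powers of `z` produced by homogeneity are units that drop out of the ideal. -/
theorem intersectionNumber_eq_length (M : GL (Fin 3) ℂ) {d d' : ℕ}
    {F F' : MvPolynomial (Fin 3) ℂ} (hF : F.IsHomogeneous d) (hF' : F'.IsHomogeneous d') :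
    intersectionNumber (imageOrigin M) F F' =
      Module.length ConeField (CompletedRing ⧸ Ideal.span
        {map (algebraMap ℂ ConeField) (localEquation (comp F M) : MvPowerSeries (Fin 2) ℂ),
          map (algebraMap ℂ ConeField) (localEquation (comp F' M) : MvPowerSeries (Fin 2) ℂ)}) := by
  have h := length_quotient_eq_of_dense (localMap M) (localMap_mem_maximalIdeal M)
    (localMap_dense M) (mem_maximalIdeal_pow_of_localMap M)
    ((Ideal.span {F, F'}).map (algebraMap (MvPolynomial (Fin 3) ℂ)
      (Localization.AtPrime (pointIdeal (imageOrigin M)))))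
  rw [intersectionNumber, h, length_quotient_eq_length_field, Ideal.map_map, Ideal.map_span,
    Set.image_pair, RingHom.comp_apply, RingHom.comp_apply, localMap_algebraMap,
    localMap_algebraMap, conePointMap_apply, conePointMap_apply,
    coneMap_of_isHomogeneous (isHomogeneous_comp hF M),
    coneMap_of_isHomogeneous (isHomogeneous_comp hF' M), Ideal.span_insert,
    Ideal.span_singleton_mul_left_unit (isUnit_coneVar d),
    Ideal.span_singleton_mul_left_unit (isUnit_coneVar d'), ← Ideal.span_insert]

end Localization

open scoped ENNReal NNReal

/-! ### Weighted norms and division of convergent series -/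

section Convergence

/-- The weight of the exponent `(i, j)` for which `x` has weight `a` and `y` has weight `1`. -/
def expoWeight (a : ℕ) (n : Fin 2 →₀ ℕ) : ℕ := a * n 0 + n 1

theorem expoWeight_add (a : ℕ) (m n : Fin 2 →₀ ℕ) :
    expoWeight a (m + n) = expoWeight a m + expoWeight a n := by
  simp only [expoWeight, Finsupp.add_apply]
  ring

/-- The weighted `ℓ¹` norm of a power series on the polydisc of radii `(ρ ^ a, ρ)`. -/
noncomputable def weightedNorm (a : ℕ) (ρ : ℝ≥0) (f : MvPowerSeries (Fin 2) ℂ) : ℝ≥0∞ :=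
  ∑' n, (‖coeff n f‖₊ : ℝ≥0∞) * (ρ : ℝ≥0∞) ^ expoWeight a n

theorem weightedNorm_mul_le (a : ℕ) (ρ : ℝ≥0) (f g : MvPowerSeries (Fin 2) ℂ) :
    weightedNorm a ρ (f * g) ≤ weightedNorm a ρ f * weightedNorm a ρ g := by
  classical
  unfold weightedNorm
  rw [← ENNReal.tsum_mul_right]
  simp_rw [← ENNReal.tsum_mul_left]
  rw [← ENNReal.tsum_prod, ← (Finset.HasAntidiagonal.sigmaAntidiagonalEquivProd (A := Fin 2 →₀ ℕ)).tsum_eq,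
    ENNReal.tsum_sigma']
  refine ENNReal.tsum_le_tsum fun n => ?_
  rw [tsum_fintype, coeff_mul]
  simp only [Finset.HasAntidiagonal.sigmaAntidiagonalEquivProd_apply]
  rw [Finset.sum_coe_sort (Finset.HasAntidiagonal.antidiagonal n) (fun p : (Fin 2 →₀ ℕ) × (Fin 2 →₀ ℕ) =>
    (‖coeff p.1 f‖₊ : ℝ≥0∞) * (ρ : ℝ≥0∞) ^ expoWeight a p.1 *
      ((‖coeff p.2 g‖₊ : ℝ≥0∞) * (ρ : ℝ≥0∞) ^ expoWeight a p.2))]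
  have h : (‖∑ p ∈ Finset.HasAntidiagonal.antidiagonal n, coeff p.1 f * coeff p.2 g‖₊ : ℝ≥0∞) ≤
      ∑ p ∈ Finset.HasAntidiagonal.antidiagonal n, (‖coeff p.1 f‖₊ : ℝ≥0∞) * ‖coeff p.2 g‖₊ := by
    refine (ENNReal.coe_le_coe.2 (nnnorm_sum_le _ _)).trans (le_of_eq ?_)
    simp
  refine (mul_le_mul_left h _).trans (le_of_eq ?_)
  rw [Finset.sum_mul]
  refine Finset.sum_congr rfl fun p hp => ?_
  rw [← Finset.HasAntidiagonal.mem_antidiagonal.1 hp, expoWeight_add, pow_add]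
  ring

theorem IsConvergent.exists_weightedNorm_ne_top {f : MvPowerSeries (Fin 2) ℂ}
    (hf : IsConvergent f) {a : ℕ} (ha : 1 ≤ a) :
    ∃ r : ℝ≥0, 0 < r ∧ ∀ ρ ≤ r, weightedNorm a ρ f ≠ ⊤ := by
  obtain ⟨r, hr, hf⟩ := hf
  -- The radius is capped at `1` because the weight dominates the degree, and larger exponents must
  -- give smaller powers.
  refine ⟨min r.toNNReal 1, by simpa using hr, fun ρ hρ => ?_⟩
  have h : weightedNorm a ρ f = ∑' n, ((‖coeff n f‖₊ * ρ ^ expoWeight a n : ℝ≥0) : ℝ≥0∞) := by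
    simp [weightedNorm]
  rw [h, ENNReal.tsum_coe_ne_top_iff_summable, ← NNReal.summable_coe]
  refine hf.of_nonneg_of_le (fun n => NNReal.coe_nonneg _) fun n => ?_
  have h1 : n.degree ≤ expoWeight a n := by
    rw [Finsupp.degree_eq_sum, Fin.sum_univ_two, expoWeight]
    nlinarith [n 0]
  have h2 : ρ ^ expoWeight a n ≤ r.toNNReal ^ n.degree :=
    (pow_le_pow_of_le_one zero_le (hρ.trans (min_le_right _ _)) h1).trans
      (pow_le_pow_left₀ zero_le (hρ.trans (min_le_left _ _)) _)
  have h3 : ((ρ ^ expoWeight a n : ℝ≥0) : ℝ) ≤ r ^ n.degree := by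
    have := NNReal.coe_le_coe.2 h2
    rwa [NNReal.coe_pow r.toNNReal, Real.coe_toNNReal r hr.le] at this
  rw [NNReal.coe_mul, coe_nnnorm]
  gcongr

theorem isConvergent_of_weightedNorm_ne_top {f : MvPowerSeries (Fin 2) ℂ} {a : ℕ} (ha : 1 ≤ a)
    {ρ : ℝ≥0} (hρ : 0 < ρ) (h : weightedNorm a ρ f ≠ ⊤) : IsConvergent f := by
  have h' : weightedNorm a ρ f = ∑' n, ((‖coeff n f‖₊ * ρ ^ expoWeight a n : ℝ≥0) : ℝ≥0∞) := by
    simp [weightedNorm]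
  rw [h', ENNReal.tsum_coe_ne_top_iff_summable, ← NNReal.summable_coe] at h
  have hm : 0 < min ρ 1 := lt_min hρ one_pos
  refine ⟨((min ρ 1 ^ a : ℝ≥0) : ℝ), by positivity,
    h.of_nonneg_of_le (fun n => by positivity) fun n => ?_⟩
  have h1 : expoWeight a n ≤ a * n.degree := by
    rw [Finsupp.degree_eq_sum, Fin.sum_univ_two, expoWeight]
    nlinarith [n 1]
  have h2 : (min ρ 1 ^ a) ^ n.degree ≤ ρ ^ expoWeight a n := by
    rw [← pow_mul]
    exact (pow_le_pow_of_le_one zero_le (min_le_right _ _) h1).trans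
      (pow_le_pow_left₀ zero_le (min_le_left _ _) _)
  rw [NNReal.coe_mul, coe_nnnorm]
  gcongr
  exact_mod_cast h2

theorem weightedNorm_smul_le {v : MvPowerSeries (Fin 2) ℂ} {a k : ℕ}
    (hv : ∀ n, expoWeight a n < k → coeff n v = 0) {s ρ : ℝ≥0} (hs : s ≤ 1) :
    weightedNorm a (s * ρ) v ≤ (s : ℝ≥0∞) ^ k * weightedNorm a ρ v := by
  unfold weightedNorm
  rw [← ENNReal.tsum_mul_left]
  refine ENNReal.tsum_le_tsum fun n => ?_
  by_cases hn : expoWeight a n < k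
  · simp [hv n hn]
  · have h1 : (s : ℝ≥0∞) ^ expoWeight a n ≤ (s : ℝ≥0∞) ^ k :=
      pow_le_pow_of_le_one zero_le (by exact_mod_cast hs) (not_lt.1 hn)
    rw [ENNReal.coe_mul, mul_pow, mul_left_comm]
    gcongr

/-- The terms of weight less than `I` of a power series. -/
noncomputable def truncWeight (a I : ℕ) (q : MvPowerSeries (Fin 2) ℂ) :
    MvPowerSeries (Fin 2) ℂ :=
  ofExpo fun i j => if a * i + j < I then coeff (expo i j) q else 0

theorem coeff_truncWeight (a I : ℕ) (q : MvPowerSeries (Fin 2) ℂ) (n : Fin 2 →₀ ℕ) :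
    coeff n (truncWeight a I q) = if expoWeight a n < I then coeff n q else 0 := by
  conv_lhs => rw [← expo_eta n, truncWeight, coeff_ofExpo, expo_eta]
  rfl

theorem weightedNorm_le_of_truncWeight {a : ℕ} {ρ : ℝ≥0} {q : MvPowerSeries (Fin 2) ℂ}
    {A : ℝ≥0∞} (h : ∀ I, weightedNorm a ρ (truncWeight a I q) ≤ A) : weightedNorm a ρ q ≤ A := by
  rw [weightedNorm, ENNReal.tsum_eq_iSup_sum]
  refine iSup_le fun s => ?_
  -- This truncation retains every exponent of the finite set `s`.
  refine le_trans ?_ (h (s.sup (expoWeight a) + 1))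
  refine le_trans (le_of_eq ?_) (ENNReal.sum_le_tsum s)
  refine Finset.sum_congr rfl fun n hn => ?_
  rw [coeff_truncWeight, if_pos (Nat.lt_succ_of_le (Finset.le_sup hn))]

/-- Write `y ^ N q = q (y ^ N + v) - v q`. All terms of `v` have weight above `N`, so in weight at
most `N + I` the product `v q` involves only the terms of `q` of weight less than `I`. The truncated
norms can therefore be bounded recursively. -/
theorem weightedNorm_truncWeight_succ_le {a N : ℕ} {q v : MvPowerSeries (Fin 2) ℂ}
    (hv : ∀ n, expoWeight a n ≤ N → coeff n v = 0) (ρ : ℝ≥0) (I : ℕ) :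
    (ρ : ℝ≥0∞) ^ N * weightedNorm a ρ (truncWeight a (I + 1) q) ≤
      weightedNorm a ρ (q * (X 1 ^ N + v)) +
        weightedNorm a ρ v * weightedNorm a ρ (truncWeight a I q) := by
  refine le_trans ?_ (add_le_add_right (weightedNorm_mul_le a ρ v (truncWeight a I q)) _)
  unfold weightedNorm
  rw [← ENNReal.tsum_mul_left, ← ENNReal.tsum_add]
  refine le_trans (ENNReal.tsum_le_tsum fun n => ?_) (ENNReal.tsum_comp_le_tsum_of_injective
    (f := fun n : Fin 2 →₀ ℕ => n + Finsupp.single 1 N) (add_left_injective _) _)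
  rw [coeff_truncWeight]
  split_ifs with hn
  · have h1 : coeff (n + Finsupp.single 1 N) (v * q) =
        coeff (n + Finsupp.single 1 N) (v * truncWeight a I q) := by
      classical
      rw [coeff_mul, coeff_mul]
      refine Finset.sum_congr rfl fun p hp => ?_
      by_cases hp1 : expoWeight a p.1 ≤ N
      · simp [hv _ hp1]
      · have hw := congrArg (expoWeight a) (Finset.HasAntidiagonal.mem_antidiagonal.1 hp)
        have hN : expoWeight a (Finsupp.single 1 N) = N := by simp [expoWeight]
        rw [expoWeight_add, expoWeight_add, hN] at hw
        rw [coeff_truncWeight, if_pos (by omega)]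
    have h2 : coeff n q = coeff (n + Finsupp.single 1 N) (q * (X 1 ^ N + v)) -
        coeff (n + Finsupp.single 1 N) (v * truncWeight a I q) := by
      rw [← h1, ← map_sub, mul_add, mul_comm v, add_sub_cancel_right, X_pow_eq,
        coeff_add_mul_monomial, mul_one]
    have h3 : expoWeight a (n + Finsupp.single 1 N) = N + expoWeight a n := by
      rw [expoWeight_add, add_comm]
      simp [expoWeight]
    rw [h3, pow_add, h2, mul_left_comm, ← add_mul]
    gcongr
    exact_mod_cast nnnorm_sub_le _ _
  · simp

/-- Since `x` has weight `N + 1`, the condition `h` concerns only the pure powers of `y` of degree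
at most `N`: it makes `y ^ N` the lowest weighted part of `w`. On a small polydisc the rest of `w`
has norm at most half of `ρ ^ N`, and the recursion bounds all truncations of `q` uniformly. -/
theorem isConvergent_of_mul {q w : MvPowerSeries (Fin 2) ℂ} (N : ℕ) (hw : IsConvergent w)
    (hq : IsConvergent (q * w))
    (h : ∀ n : Fin 2 →₀ ℕ, expoWeight (N + 1) n ≤ N → coeff n w = coeff n (X 1 ^ N)) :
    IsConvergent q := by
  obtain ⟨v, rfl⟩ : ∃ v, w = X 1 ^ N + v := ⟨w - X 1 ^ N, by ring⟩
  have hv : ∀ n : Fin 2 →₀ ℕ, expoWeight (N + 1) n ≤ N → coeff n v = 0 := fun n hn => by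
    simpa using h n hn
  have hvc : IsConvergent v := by
    have hX : IsConvergent (X 1 ^ N : MvPowerSeries (Fin 2) ℂ) := by
      have := isConvergent_coe (MvPolynomial.X 1 ^ N : MvPolynomial (Fin 2) ℂ)
      rwa [MvPolynomial.coe_pow, MvPolynomial.coe_X] at this
    have := (ConvergentSeries (Fin 2)).sub_mem hw hX
    rwa [add_sub_cancel_left] at this
  obtain ⟨r, hr, hrv⟩ := hvc.exists_weightedNorm_ne_top (a := N + 1) (by omega)
  obtain ⟨r', hr', hrq⟩ := hq.exists_weightedNorm_ne_top (a := N + 1) (by omega)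
  set ρ₀ := min r r' with hρ₀
  have hρ₀pos : 0 < ρ₀ := lt_min hr hr'
  obtain ⟨V, hV⟩ : ∃ V : ℝ≥0, (V : ℝ≥0∞) = weightedNorm (N + 1) ρ₀ v :=
    ⟨_, ENNReal.coe_toNNReal (hrv ρ₀ (min_le_left _ _))⟩
  -- Shrinking the radius by `s` multiplies the norm of `v` by at most `s ^ (N + 1)` but `ρ₀ ^ N`
  -- only by `s ^ N`; the extra factor `s` is what yields the half.
  obtain ⟨s, hs, hs1, hsV⟩ : ∃ s : ℝ≥0, 0 < s ∧ s ≤ 1 ∧ 2 * (s * V) ≤ ρ₀ ^ N := by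
    refine ⟨min 1 (ρ₀ ^ N / (2 * (V + 1))), lt_min one_pos (by positivity), min_le_left _ _, ?_⟩
    calc 2 * (min 1 (ρ₀ ^ N / (2 * (V + 1))) * V)
        ≤ 2 * (ρ₀ ^ N / (2 * (V + 1)) * (V + 1)) := by
          gcongr
          · exact min_le_right _ _
          · exact le_self_add
      _ = ρ₀ ^ N := by field_simp
  set ρ := s * ρ₀ with hρ
  have hρpos : 0 < ρ := by positivity
  have hρle : ρ ≤ ρ₀ := mul_le_of_le_one_left zero_le hs1
  have h1 : 2 * weightedNorm (N + 1) ρ v ≤ (ρ : ℝ≥0∞) ^ N := by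
    have h2 := weightedNorm_smul_le (k := N + 1) (s := s) (ρ := ρ₀)
      (fun n hn => hv n (Nat.lt_succ_iff.1 hn)) hs1
    rw [← hV] at h2
    refine (mul_le_mul_right h2 2).trans ?_
    have h3 : 2 * (s ^ (N + 1) * V) ≤ ρ ^ N := by
      rw [hρ, mul_pow]
      calc 2 * (s ^ (N + 1) * V) = s ^ N * (2 * (s * V)) := by ring
        _ ≤ s ^ N * ρ₀ ^ N := by gcongr
    exact_mod_cast h3
  obtain ⟨A, hA⟩ : ∃ A : ℝ≥0, (A : ℝ≥0∞) = weightedNorm (N + 1) ρ (q * (X 1 ^ N + v)) :=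
    ⟨_, ENNReal.coe_toNNReal (hrq ρ (hρle.trans (min_le_right _ _)))⟩
  have hP : (ρ : ℝ≥0∞) ^ N ≠ 0 := pow_ne_zero _ (by exact_mod_cast hρpos.ne')
  have hP' : (ρ : ℝ≥0∞) ^ N ≠ ⊤ := ENNReal.pow_ne_top ENNReal.coe_ne_top
  have key (I : ℕ) : (ρ : ℝ≥0∞) ^ N * weightedNorm (N + 1) ρ (truncWeight (N + 1) I q) ≤ 2 * A := by
    induction I with
    | zero =>
      have : truncWeight (N + 1) 0 q = 0 := by
        ext n
        simp [coeff_truncWeight]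
      simp [this, weightedNorm]
    | succ I ih =>
      refine (weightedNorm_truncWeight_succ_le hv ρ I).trans ?_
      rw [← hA, two_mul]
      refine add_le_add_right ?_ _
      -- The factor one half closes the induction: the error term is at most `A`, so the bound `2 *
      -- A` reproduces itself.
      have h5 : 2 * (weightedNorm (N + 1) ρ v * weightedNorm (N + 1) ρ (truncWeight (N + 1) I q)) ≤
          2 * A := by
        rw [← mul_assoc]
        exact (mul_le_mul_left h1 _).trans ih
      exact (ENNReal.mul_le_mul_iff_right (by simp) (by simp)).1 h5
  refine isConvergent_of_weightedNorm_ne_top (a := N + 1) (by omega) hρpos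
    (ne_top_of_le_ne_top (b := 2 * (A : ℝ≥0∞) / (ρ : ℝ≥0∞) ^ N) ?_
      (weightedNorm_le_of_truncWeight fun I => ?_))
  · exact ENNReal.div_ne_top (ENNReal.mul_ne_top (by simp) ENNReal.coe_ne_top) hP
  · rw [ENNReal.le_div_iff_mul_le (Or.inl hP) (Or.inl hP'), mul_comm]
    exact key I

theorem isUnit_of_constantCoeff_ne_zero {B : ConvergentSeries (Fin 2)}
    (hB : constantCoeff (B : MvPowerSeries (Fin 2) ℂ) ≠ 0) : IsUnit B := by
  set f : MvPowerSeries (Fin 2) ℂ := (B : MvPowerSeries (Fin 2) ℂ)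
  set k := constantCoeff f
  -- Dividing `f` by its constant term makes its lowest part `1 = y ^ 0`, so that the division
  -- criterion applies with `N = 0` to the inverse.
  have h1 : (C k * f⁻¹) * (C k⁻¹ * f) = 1 := by
    rw [mul_mul_mul_comm, ← map_mul, mul_inv_cancel₀ hB, map_one, one_mul,
      MvPowerSeries.inv_mul_cancel f hB]
  have hC (z : ℂ) : IsConvergent (C z : MvPowerSeries (Fin 2) ℂ) := by
    have := isConvergent_coe (MvPolynomial.C z : MvPolynomial (Fin 2) ℂ)
    rwa [MvPolynomial.coe_C] at this
  have h2 : IsConvergent (C k * f⁻¹) := by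
    refine isConvergent_of_mul 0 ((hC k⁻¹).mul B.2) ?_ fun n hn => ?_
    · rw [h1]
      exact (ConvergentSeries (Fin 2)).one_mem
    · have hn0 : n = 0 := by
        rw [expoWeight] at hn
        ext i
        fin_cases i
        · change n 0 = 0; omega
        · change n 1 = 0; omega
      subst hn0
      rw [pow_zero, coeff_C_mul]
      simp only [coeff_zero_eq_constantCoeff, map_one]
      exact inv_mul_cancel₀ hB
  have h3 : f * (C k⁻¹ * (C k * f⁻¹)) = 1 := by rw [← h1]; ring
  exact IsUnit.of_mul_eq_one ⟨C k⁻¹ * (C k * f⁻¹), (hC _).mul h2⟩ (Subtype.ext h3)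

end Convergence

/-! ### Factorisation of a branch into conjugate factors -/

section Branches

theorem prod_dvd_of_prime {R ι : Type*} [CommRing R] [IsDomain R] (s : Finset ι) (p : ι → R)
    (hp : ∀ i ∈ s, Prime (p i)) (hne : ∀ i ∈ s, ∀ j ∈ s, p i ∣ p j → i = j) {f : R}
    (hf : ∀ i ∈ s, p i ∣ f) : ∏ i ∈ s, p i ∣ f := by
  classical
  induction s using Finset.induction_on generalizing f with
  | empty => simp
  | insert a s ha ih =>
    rw [Finset.prod_insert ha]
    obtain ⟨g, rfl⟩ := hf a (Finset.mem_insert_self _ _)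
    refine mul_dvd_mul_left _ (ih (fun i hi => hp i (Finset.mem_insert_of_mem hi))
      (fun i hi j hj => hne i (Finset.mem_insert_of_mem hi) j (Finset.mem_insert_of_mem hj))
      fun i hi => ?_)
    refine ((hp i (Finset.mem_insert_of_mem hi)).dvd_or_dvd
      (hf i (Finset.mem_insert_of_mem hi))).resolve_left fun h => ?_
    have := hne i (Finset.mem_insert_of_mem hi) a (Finset.mem_insert_self _ _) h
    exact ha (this ▸ hi)

variable {K : Type*} [Field K]

/-- The inclusion of the variable `y` among the variables `x, y`. -/
def embY : Unit ↪ Fin 2 := ⟨fun _ => 1, fun _ _ _ => rfl⟩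

/-- The restriction `f(0, y)` of a series `f(x, y)`. -/
noncomputable def restrictY : MvPowerSeries (Fin 2) K →ₐ[K] PowerSeries K :=
  MvPowerSeries.killCompl embY

theorem coeff_restrictY (f : MvPowerSeries (Fin 2) K) (n : ℕ) :
    PowerSeries.coeff n (restrictY f) = coeff (expo 0 n) f := by
  have h : (Finsupp.single () n).embDomain embY = expo 0 n := by
    rw [Finsupp.embDomain_single]
    simp only [expo, Finsupp.single_zero, zero_add]
    rfl
  rw [restrictY, PowerSeries.coeff, coeff_killCompl, h]

theorem restrictY_linearFactor {c : PowerSeries K} (hc : PowerSeries.constantCoeff c = 0) :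
    restrictY (linearFactor c) = PowerSeries.X := by
  have h0 : restrictY (inX c) = 0 := by
    ext n
    rw [coeff_restrictY, map_zero]
    rcases Nat.eq_zero_or_pos n with rfl | hn
    · have : expo 0 0 = 0 := by simp [expo]
      rw [this, coeff_zero_eq_constantCoeff, constantCoeff_inX, hc]
    · refine coeff_rename_eq_zero _ _ ?_
      rintro ⟨y, hy⟩
      have := DFunLike.congr_fun hy 1
      rw [Finsupp.mapDomain_of_notMem_range _ _ (by simp), expo_one] at this
      omega
  rw [linearFactor, map_sub, h0, sub_zero]
  exact killCompl_X (e := embY) ()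

theorem order_le_order_restrictY (f : MvPowerSeries (Fin 2) K) :
    f.order ≤ (restrictY f).order := by
  refine PowerSeries.le_order _ _ fun i hi => ?_
  rw [coeff_restrictY]
  refine coeff_of_lt_order (lt_of_eq_of_lt ?_ hi)
  simp [expo]

theorem order_restrictY_of_isUnit {f : MvPowerSeries (Fin 2) K} (hf : IsUnit f) :
    (restrictY f).order = 0 :=
  PowerSeries.order_zero_of_unit (hf.map restrictY)

theorem order_of_isUnit {f : MvPowerSeries (Fin 2) K} (hf : IsUnit f) : f.order = 0 :=
  le_antisymm ((order_le_order_restrictY f).trans (order_restrictY_of_isUnit hf).le) (zero_le)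

/-- For each factor the order can only increase on setting `x = 0`. Orders add over the product, so
equality for `f` forces equality for every factor. -/
theorem order_restrictY_eq_of_prod {ι : Type*} [Fintype ι] {f u : MvPowerSeries (Fin 2) K}
    {B : ι → MvPowerSeries (Fin 2) K} (hu : IsUnit u) (hf : f = u * ∏ i, B i)
    (h0 : restrictY f ≠ 0) (h : (restrictY f).order = f.order) (i : ι) :
    (restrictY (B i)).order = (B i).order := by
  have hB (i : ι) : restrictY (B i) ≠ 0 := by
    intro h'
    apply h0
    rw [hf, map_mul, map_prod, Finset.prod_eq_zero (Finset.mem_univ i) h', mul_zero]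
  have hx (i : ι) : ∃ n : ℕ, (restrictY (B i)).order = n :=
    ⟨_, (PowerSeries.coe_toNat_order (hB i)).symm⟩
  have hy (i : ι) : ∃ n : ℕ, (B i).order = n := by
    refine ⟨_, (ne_zero_iff_order_finite.1 ?_).symm⟩
    intro h'
    exact hB i (by rw [h', map_zero])
  choose n hn using hx
  choose k hk using hy
  have hle (i : ι) : k i ≤ n i := by
    have := order_le_order_restrictY (B i)
    rw [hn, hk] at this
    exact_mod_cast this
  rw [hf, map_mul, map_prod, PowerSeries.order_mul, order_mul, order_restrictY_of_isUnit hu,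
    order_of_isUnit hu, zero_add, zero_add, PowerSeries.order_prod, order_prod] at h
  simp only [hn, hk] at h
  have h' : ∑ i, k i = ∑ i, n i := by exact_mod_cast h.symm
  have := (Finset.sum_eq_sum_iff_of_le fun i _ => hle i).1 h' i (Finset.mem_univ i)
  rw [hn, hk, this]

/-- If `y ^ k` were absent from the lowest homogeneous part, of degree `k`, then each of its
monomials would contain `x` and the tangent cone would contain the line `x = 0`. -/
theorem order_restrictY_localEquation {G : MvPolynomial (Fin 3) ℂ}
    (hT : ¬ lineX ⊆ tangentCone G) :
    restrictY (localEquation G : MvPowerSeries (Fin 2) ℂ) ≠ 0 ∧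
      (restrictY (localEquation G : MvPowerSeries (Fin 2) ℂ)).order =
        (localEquation G : MvPowerSeries (Fin 2) ℂ).order := by
  set f := localEquation G with hf
  set k := (f : MvPowerSeries (Fin 2) ℂ).order.toNat with hk
  have hc : MvPolynomial.coeff (expo 0 k) f ≠ 0 := by
    intro h0
    apply hT
    intro v hv
    change MvPolynomial.eval v (MvPolynomial.homogeneousComponent k f) = 0
    rw [MvPolynomial.eval_eq]
    refine Finset.sum_eq_zero fun n hn => ?_
    have hn' : n.degree = k := by
      by_contra h
      rw [MvPolynomial.mem_support_iff, MvPolynomial.coeff_homogeneousComponent, if_neg h] at hn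
      exact hn rfl
    by_cases h1 : n 0 = 0
    · have : n = expo 0 k := by
        rw [Finsupp.degree_eq_sum, Fin.sum_univ_two, h1, zero_add] at hn'
        rw [← expo_eta n, h1, hn']
      rw [MvPolynomial.coeff_homogeneousComponent, this, h0]
      simp
    · rw [Finset.prod_eq_zero (i := 0) (by simpa using h1), mul_zero]
      rw [show v 0 = 0 from hv, zero_pow h1]
  have hc' : PowerSeries.coeff k (restrictY (f : MvPowerSeries (Fin 2) ℂ)) ≠ 0 := by
    rwa [coeff_restrictY, MvPolynomial.coeff_coe]
  have h0 : restrictY (f : MvPowerSeries (Fin 2) ℂ) ≠ 0 := by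
    intro h
    rw [h, map_zero] at hc'
    exact hc' rfl
  refine ⟨h0, le_antisymm ?_ (order_le_order_restrictY _)⟩
  refine (PowerSeries.order_le _ hc').trans (le_of_eq (ne_zero_iff_order_finite.1 ?_))
  intro h
  exact h0 (by rw [h, map_zero])

theorem isConvergent_inX {c : PowerSeries ℂ} (hc : c ∈ ConvergentSeries Unit) :
    IsConvergent (inX c) := by
  obtain ⟨r, hr, hs⟩ := hc
  refine ⟨r, hr, ?_⟩
  let e : Unit ↪ Fin 2 := ⟨fun _ => 0, fun _ _ _ => rfl⟩
  have hinj : Function.Injective (Finsupp.embDomain e : (Unit →₀ ℕ) → (Fin 2 →₀ ℕ)) :=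
    Finsupp.embDomain_injective e
  rw [← hinj.summable_iff]
  · refine hs.congr fun n => ?_
    have h1 : coeff (n.embDomain e) (inX c) = coeff n c := coeff_embDomain_rename e c n
    have h2 : (n.embDomain e).degree = n.degree := by
      rw [Finsupp.unique_single n, Finsupp.embDomain_single, Finsupp.degree_single,
        Finsupp.degree_single]
    rw [Function.comp_apply, h1, h2]
  · intro n hn
    have : coeff n (inX c) = 0 := by
      refine coeff_rename_eq_zero _ _ ?_
      rintro ⟨y, hy⟩
      exact hn ⟨y, by rw [Finsupp.embDomain_eq_mapDomain]; exact hy⟩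
    simp [this]

theorem rescale_mem_convergentSeries {c : PowerSeries ℂ} (hc : c ∈ ConvergentSeries Unit) {z : ℂ}
    (hz : ‖z‖ = 1) : PowerSeries.rescale z c ∈ ConvergentSeries Unit := by
  obtain ⟨r, hr, hs⟩ := hc
  refine ⟨r, hr, hs.congr fun n => ?_⟩
  rw [PowerSeries.rescale_eq, MvPowerSeries.coeff_rescale, norm_mul, Finsupp.prod, norm_prod]
  simp [hz]

theorem isConvergent_linearFactor {c : PowerSeries ℂ} (hc : c ∈ ConvergentSeries Unit) :
    linearFactor c ∈ ConvergentSeries (Fin 2) := by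
  refine sub_mem ?_ (isConvergent_inX hc)
  have := isConvergent_coe (MvPolynomial.X 1 : MvPolynomial (Fin 2) ℂ)
  rwa [MvPolynomial.coe_X] at this

theorem isConvergent_of_ramify {N : ℕ} (hN : N ≠ 0) {f : MvPowerSeries (Fin 2) ℂ}
    (hf : IsConvergent (ramify hN f)) : IsConvergent f := by
  obtain ⟨r, hr, hs⟩ := hf
  have hm : 0 < min r 1 := lt_min hr one_pos
  have hinj : Function.Injective fun n : Fin 2 →₀ ℕ => expo (N * n 0) (n 1) := by
    intro m n h
    obtain ⟨h0, h1⟩ := expo_inj.1 h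
    rw [← expo_eta m, ← expo_eta n, h1, Nat.eq_of_mul_eq_mul_left (Nat.pos_of_ne_zero hN) h0]
  refine ⟨min r 1 ^ N, by positivity, (hs.comp_injective hinj).of_nonneg_of_le
    (fun n => by positivity) fun n => ?_⟩
  rw [Function.comp_apply, coeff_mul_expo, expo_eta, ← pow_mul]
  gcongr
  have h1 : (expo (N * n 0) (n 1)).degree ≤ N * n.degree := by
    rw [Finsupp.degree_eq_sum, Finsupp.degree_eq_sum, Fin.sum_univ_two, Fin.sum_univ_two, expo_zero,
      expo_one]
    nlinarith [n 1, Nat.one_le_iff_ne_zero.2 hN, Nat.le_mul_of_pos_left (n 1) (Nat.pos_of_ne_zero hN)]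
  exact (pow_le_pow_of_le_one hm.le (min_le_right _ _) h1).trans
    (pow_le_pow_left₀ hm.le (min_le_left _ _) _)

theorem not_dvd_linearFactor {c c' : PowerSeries K} (hc : PowerSeries.constantCoeff c = 0)
    (h : linearFactor c ∣ linearFactor c') : c = c' := by
  rw [linearFactor_dvd_iff c hc, evalAt_linearFactor] at h
  exact sub_eq_zero.1 h

theorem linearFactor_rescale_dvd {c : PowerSeries K} {ζ : K} {f : MvPowerSeries (Fin 2) K}
    (hf : rescale ![ζ, 1] f = f) (h : linearFactor c ∣ f) :
    linearFactor (PowerSeries.rescale ζ c) ∣ f := by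
  have := map_dvd (rescale ![ζ, 1]) h
  rwa [hf, rescale_linearFactor] at this

theorem isUnit_coe {B : ConvergentSeries (Fin 2)} (hB : IsUnit B) :
    IsUnit (B : MvPowerSeries (Fin 2) ℂ) :=
  hB.map (ConvergentSeries (Fin 2)).val

theorem constantCoeff_eq_zero_of_irreducible {B : ConvergentSeries (Fin 2)} (hB : Irreducible B) :
    constantCoeff (B : MvPowerSeries (Fin 2) ℂ) = 0 := by
  by_contra h
  exact hB.not_isUnit (isUnit_of_constantCoeff_ne_zero h)

theorem branchMultiplicity_ne_zero {B : ConvergentSeries (Fin 2)} (hB : Irreducible B) :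
    branchMultiplicity B ≠ 0 := by
  intro h
  rw [branchMultiplicity, ENat.toNat_eq_zero] at h
  rcases h with h | h
  · exact order_ne_zero_iff_constCoeff_eq_zero.2 (constantCoeff_eq_zero_of_irreducible hB) h
  · rw [order_eq_top_iff] at h
    exact hB.ne_zero (Subtype.ext h)

theorem rescale_pow_mem_convergentSeries {c : PowerSeries ℂ} (hc : c ∈ ConvergentSeries Unit)
    {e : ℕ} (he : e ≠ 0) {ζ : ℂ} (hζ : IsPrimitiveRoot ζ e) (j : ℕ) :
    PowerSeries.rescale (ζ ^ j) c ∈ ConvergentSeries Unit :=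
  rescale_mem_convergentSeries hc (by rw [norm_pow, hζ.norm'_eq_one he, one_pow])

theorem constantCoeff_rescale {c : PowerSeries K} (hc : PowerSeries.constantCoeff c = 0) (z : K) :
    PowerSeries.constantCoeff (PowerSeries.rescale z c) = 0 := by
  rw [← PowerSeries.coeff_zero_eq_constantCoeff_apply, PowerSeries.coeff_rescale]
  simp [hc]

theorem ramify_eq_prod_linearFactor {B : ConvergentSeries (Fin 2)} (hB : Irreducible B)
    (hord : (restrictY (B : MvPowerSeries (Fin 2) ℂ)).order = branchMultiplicity B)
    {h : PowerSeries ℂ} (hh : IsParametrization B h) {ζ : ℂ}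
    (hζ : IsPrimitiveRoot ζ (branchMultiplicity B)) :
    ∃ u : MvPowerSeries (Fin 2) ℂ, IsUnit u ∧
      ramify (branchMultiplicity_ne_zero hB) (B : MvPowerSeries (Fin 2) ℂ) =
        ramify (branchMultiplicity_ne_zero hB) u *
          ∏ j ∈ Finset.range (branchMultiplicity B), linearFactor (PowerSeries.rescale (ζ ^ j) h) := by
  classical
  set e := branchMultiplicity B with he
  have he0 : e ≠ 0 := branchMultiplicity_ne_zero hB
  have hcc (j : ℕ) : PowerSeries.constantCoeff (PowerSeries.rescale (ζ ^ j) h) = 0 :=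
    constantCoeff_rescale hh.constantCoeff _
  -- The conjugates are taken as a set, since they are not yet known to be distinct; this comes out
  -- of the final count.
  set s : Finset (PowerSeries ℂ) :=
    (Finset.range e).image fun j => PowerSeries.rescale (ζ ^ j) h with hs
  have hs0 : ∀ c ∈ s, PowerSeries.constantCoeff c = 0 := by
    intro c hc
    obtain ⟨j, -, rfl⟩ := Finset.mem_image.1 hc
    exact hcc j
  have hdvd : ∏ c ∈ s, linearFactor c ∣ ramify he0 (B : MvPowerSeries (Fin 2) ℂ) := by
    refine prod_dvd_of_prime s _ (fun c hc => prime_linearFactor c (hs0 c hc))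
      (fun c hc c' _ h => not_dvd_linearFactor (hs0 c hc) h) fun c hc => ?_
    obtain ⟨j, -, rfl⟩ := Finset.mem_image.1 hc
    refine linearFactor_rescale_dvd (rescale_ramify he0 ?_ _) ?_
    · rw [← pow_mul, mul_comm, pow_mul, hζ.pow_eq_one, one_pow]
    · rw [linearFactor_dvd_iff h hh.constantCoeff, evalAt_ramify]
      exact hh.vanish
  have hinv : rescale ![ζ, 1] (∏ c ∈ s, linearFactor c) = ∏ c ∈ s, linearFactor c := by
    -- Multiplying `t` by `ζ` permutes the conjugates, with indices taken modulo `e`.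
    have hsub : s.image (PowerSeries.rescale ζ) ⊆ s := by
      intro c hc
      obtain ⟨_, hc', rfl⟩ := Finset.mem_image.1 hc
      obtain ⟨j, -, rfl⟩ := Finset.mem_image.1 hc'
      refine Finset.mem_image.2 ⟨(j + 1) % e, Finset.mem_range.2 (Nat.mod_lt _
        (Nat.pos_of_ne_zero he0)), ?_⟩
      have hmod : ζ ^ ((j + 1) % e) = ζ ^ (j + 1) := by
        conv_lhs => rw [hζ.eq_orderOf, pow_mod_orderOf]
      rw [hmod, PowerSeries.rescale_rescale, pow_succ]
    have hinj := PowerSeries.rescale_injective (R := ℂ) (hζ.ne_zero he0)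
    have heq : s.image (PowerSeries.rescale ζ) = s :=
      Finset.eq_of_subset_of_card_le hsub (Finset.card_image_of_injective s hinj).ge
    rw [map_prod]
    conv_rhs => rw [← heq, Finset.prod_image hinj.injOn]
    exact Finset.prod_congr rfl fun c _ => rescale_linearFactor ζ c
  obtain ⟨Q, hQ⟩ := exists_ramify_eq_of_rescale he0 hζ hinv
  have hprod0 : ∏ c ∈ s, linearFactor c ≠ 0 :=
    Finset.prod_ne_zero_iff.2 fun c _ => linearFactor_ne_zero c
  obtain ⟨q', hq'⟩ := hdvd
  have hq'inv : rescale ![ζ, 1] q' = q' := by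
    have := congrArg (rescale ![ζ, 1]) hq'
    rw [rescale_ramify he0 hζ.pow_eq_one, map_mul, hinv, hq'] at this
    exact (mul_left_cancel₀ hprod0 this).symm
  obtain ⟨q, rfl⟩ := exists_ramify_eq_of_rescale he0 hζ hq'inv
  rw [← hQ, ← map_mul] at hq'
  have hBq : (B : MvPowerSeries (Fin 2) ℂ) = q * Q := by
    rw [mul_comm]
    exact ramify_injective he0 hq'
  have hQc : IsConvergent Q := by
    refine isConvergent_of_ramify he0 ?_
    rw [hQ]
    refine (ConvergentSeries (Fin 2)).prod_mem fun c hc => ?_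
    obtain ⟨j, -, rfl⟩ := Finset.mem_image.1 hc
    exact isConvergent_linearFactor (rescale_pow_mem_convergentSeries hh.convergent he0 hζ j)
  have hQy (j : ℕ) : coeff (expo 0 j) Q = PowerSeries.coeff j (PowerSeries.X ^ s.card : PowerSeries ℂ) := by
    have h1 := coeff_mul_expo he0 Q 0 j
    rw [mul_zero, hQ, ← coeff_restrictY, map_prod,
      Finset.prod_congr rfl fun c hc => restrictY_linearFactor (hs0 c hc), Finset.prod_const] at h1
    exact h1.symm
  have hQr : restrictY Q = PowerSeries.X ^ s.card := by
    ext j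
    rw [coeff_restrictY, hQy]
  -- Every factor `y - c` restricts to `y` at `x = 0`, so `Q(0, y)` is exactly `y ^ s.card`, as the
  -- division criterion requires.
  have hqc : IsConvergent q := by
    refine isConvergent_of_mul s.card hQc (hBq ▸ B.2) fun n hn => ?_
    have hn0 : n 0 = 0 := by
      by_contra h0
      rw [expoWeight] at hn
      have := Nat.le_mul_of_pos_right (s.card + 1) (Nat.pos_of_ne_zero h0)
      omega
    rw [← expo_eta n, hn0, hQy, X_pow_eq, coeff_monomial, PowerSeries.coeff_X_pow]
    have : expo 0 (n 1) = Finsupp.single 1 s.card ↔ n 1 = s.card := by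
      have h2 : Finsupp.single 1 s.card = expo 0 s.card := by simp [expo]
      rw [h2, expo_inj]
      simp
    simp only [this]
  have hcard : s.card ≠ 0 := by
    rw [Finset.card_ne_zero, hs, Finset.image_nonempty, Finset.nonempty_range_iff]
    exact he0
  -- `Q` cannot be the unit in this factorisation of the irreducible `B`, because `Q(0, y)` is a
  -- positive power of `y`.
  have hqu : IsUnit q := by
    have h1 : B = (⟨q, hqc⟩ : ConvergentSeries (Fin 2)) * ⟨Q, hQc⟩ := Subtype.ext hBq
    rcases hB.isUnit_or_isUnit h1 with h2 | h2
    · exact isUnit_coe h2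
    · exfalso
      have h3 := order_restrictY_of_isUnit (isUnit_coe h2)
      change (restrictY Q).order = 0 at h3
      rw [hQr, PowerSeries.order_X_pow] at h3
      exact hcard (by exact_mod_cast h3)
  -- Comparing the orders at `x = 0` counts the conjugates, and so shows that they are distinct.
  have hcard' : s.card = e := by
    rw [hBq, map_mul, PowerSeries.order_mul, order_restrictY_of_isUnit hqu, zero_add, hQr,
      PowerSeries.order_X_pow] at hord
    exact_mod_cast hord
  have hinj : Set.InjOn (fun j => PowerSeries.rescale (ζ ^ j) h) (Finset.range e) :=
    Finset.card_image_iff.1 (by rw [← hs, hcard', Finset.card_range])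
  refine ⟨q, hqu, ?_⟩
  rw [← Finset.prod_image (f := linearFactor) hinj, ← hs, ← hQ, hq', map_mul, mul_comm]

end Branches

/-! ### Series with rational exponents and valuations along probranches -/

section Puiseux

theorem coeff_heval_single {q : ℚ} (hq : 0 < q) {z : ℂ} (hz : z ≠ 0) (p : PowerSeries ℂ) (r : ℚ) :
    (PowerSeries.heval (HahnSeries.single q z) p).coeff r =
      ∑ᶠ n : ℕ, if r = n * q then PowerSeries.coeff n p * z ^ n else 0 := by
  rw [PowerSeries.coeff_heval]
  refine finsum_congr fun n => ?_
  have h0 : 0 < (HahnSeries.single q z : Puiseux).orderTop := by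
    rw [HahnSeries.orderTop_single hz]
    exact_mod_cast hq
  change ((HahnSeries.SummableFamily.powerSeriesFamily _ p) n).coeff r = _
  rw [HahnSeries.SummableFamily.powerSeriesFamily_of_orderTop_pos h0, HahnSeries.single_pow,
    HahnSeries.coeff_smul, HahnSeries.coeff_single, nsmul_eq_mul, smul_ite, smul_zero, smul_eq_mul]
  split_ifs <;> rfl

theorem coeff_heval_single_mul {q : ℚ} (hq : 0 < q) {z : ℂ} (hz : z ≠ 0) (p : PowerSeries ℂ)
    (n : ℕ) : (PowerSeries.heval (HahnSeries.single q z) p).coeff (n * q) =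
      PowerSeries.coeff n p * z ^ n := by
  rw [coeff_heval_single hq hz, finsum_eq_single _ n, if_pos rfl]
  intro k hk
  rw [if_neg]
  intro h
  exact hk (by exact_mod_cast (mul_right_cancel₀ hq.ne' h).symm)

theorem coeff_heval_single_of_ne {q : ℚ} (hq : 0 < q) {z : ℂ} (hz : z ≠ 0) (p : PowerSeries ℂ)
    {r : ℚ} (hr : ∀ n : ℕ, r ≠ n * q) :
    (PowerSeries.heval (HahnSeries.single q z) p).coeff r = 0 := by
  rw [coeff_heval_single hq hz]
  exact (finsum_congr fun n => if_neg (hr n)).trans finsum_zero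

theorem orderTop_heval_single {q : ℚ} (hq : 0 < q) {z : ℂ} (hz : z ≠ 0) (p : PowerSeries ℂ) :
    (PowerSeries.heval (HahnSeries.single q z) p).orderTop =
      ENat.map (fun k : ℕ => (k : ℚ) * q) p.order := by
  by_cases hp : p = 0
  · rw [hp, map_zero, HahnSeries.orderTop_zero, PowerSeries.order_zero, ENat.map_top]
  · rw [← PowerSeries.coe_toNat_order hp, ENat.map_natCast]
    refine HahnSeries.orderTop_eq_of_le ?_ fun r hr => ?_
    · rw [HahnSeries.mem_support, coeff_heval_single_mul hq hz]
      exact mul_ne_zero (PowerSeries.coeff_order hp) (pow_ne_zero _ hz)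
    · rw [HahnSeries.mem_support] at hr
      by_cases h : ∃ n : ℕ, r = n * q
      · obtain ⟨n, rfl⟩ := h
        rw [coeff_heval_single_mul hq hz] at hr
        have hn : p.order.toNat ≤ n := by
          by_contra hlt
          exact hr (by rw [PowerSeries.coeff_of_lt_order_toNat n (not_le.1 hlt), zero_mul])
        gcongr
      · push Not at h
        exact absurd (coeff_heval_single_of_ne hq hz p h) hr

/-- The series `h(ζʲ t ^ (N / e))` with `ζ = exp(2iπ/e)`. -/
noncomputable def branchRoot (N e : ℕ) (h : PowerSeries ℂ) (j : ℕ) : PowerSeries ℂ :=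
  PowerSeries.subst (PowerSeries.X ^ (N / e) : PowerSeries ℂ)
    (PowerSeries.rescale (Complex.exp (2 * Real.pi * Complex.I / e) ^ j) h)

theorem branchRoot_mul {e k : ℕ} (he : e ≠ 0) (h : PowerSeries ℂ) (j : ℕ) :
    branchRoot (e * k) e h j = PowerSeries.subst (PowerSeries.X ^ k : PowerSeries ℂ)
      (PowerSeries.rescale (Complex.exp (2 * Real.pi * Complex.I / e) ^ j) h) := by
  rw [branchRoot, Nat.mul_div_cancel_left _ (Nat.pos_of_ne_zero he)]

theorem coeff_branchRoot {e k : ℕ} (he : e ≠ 0) (hk : k ≠ 0) (h : PowerSeries ℂ) (j n : ℕ) :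
    PowerSeries.coeff n (branchRoot (e * k) e h j) = if k ∣ n then
      (Complex.exp (2 * Real.pi * Complex.I / e) ^ j) ^ (n / k) * PowerSeries.coeff (n / k) h
      else 0 := by
  rw [branchRoot_mul he, ← PowerSeries.expand_apply k hk, PowerSeries.coeff_expand,
    PowerSeries.coeff_rescale]

theorem constantCoeff_branchRoot {e k : ℕ} (he : e ≠ 0) (hk : k ≠ 0) {h : PowerSeries ℂ}
    (hh : PowerSeries.constantCoeff h = 0) (j : ℕ) :
    PowerSeries.constantCoeff (branchRoot (e * k) e h j) = 0 := by
  rw [← PowerSeries.coeff_zero_eq_constantCoeff_apply, coeff_branchRoot he hk]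
  simp [hh]

/-- With `t = x ^ (1 / N)` and `N = e k`, one has `t ^ k = x ^ (1 / e)`. All probranches thus become
power series in one uniformizer. -/
theorem heval_branchRoot {e k : ℕ} (he : e ≠ 0) (hk : k ≠ 0) (h : PowerSeries ℂ) (j : ℕ) :
    PowerSeries.heval (HahnSeries.single (1 / ((e * k : ℕ) : ℚ)) 1) (branchRoot (e * k) e h j) =
      probranch e h j := by
  have he' : (0 : ℚ) < e := by exact_mod_cast Nat.pos_of_ne_zero he
  have hk' : (0 : ℚ) < k := by exact_mod_cast Nat.pos_of_ne_zero hk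
  have hq : (0 : ℚ) < 1 / e := by positivity
  have hq' : (0 : ℚ) < 1 / ((e * k : ℕ) : ℚ) := by
    rw [Nat.cast_mul]
    positivity
  have hz : Complex.exp (2 * Real.pi * Complex.I / e) ^ j ≠ 0 := pow_ne_zero _ (Complex.exp_ne_zero _)
  have hkq : (k : ℚ) * (1 / ((e * k : ℕ) : ℚ)) = 1 / e := by
    rw [Nat.cast_mul]
    field_simp
  ext r
  rw [probranch]
  by_cases h1 : ∃ n : ℕ, r = n * (1 / ((e * k : ℕ) : ℚ))
  · obtain ⟨n, rfl⟩ := h1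
    rw [coeff_heval_single_mul hq' one_ne_zero, coeff_branchRoot he hk, one_pow, mul_one]
    split_ifs with hd
    · obtain ⟨l, rfl⟩ := hd
      rw [Nat.mul_div_cancel_left _ (Nat.pos_of_ne_zero hk), Nat.cast_mul k l, mul_comm (k : ℚ) l, mul_assoc (l : ℚ),
        hkq, coeff_heval_single_mul hq hz, mul_comm]
    · rw [coeff_heval_single_of_ne hq hz]
      intro l hl
      rw [← hkq, ← mul_assoc] at hl
      have := mul_right_cancel₀ hq'.ne' hl
      exact hd ⟨l, by rw [mul_comm]; exact_mod_cast this⟩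
  · push Not at h1
    rw [coeff_heval_single_of_ne hq' one_ne_zero _ h1, coeff_heval_single_of_ne hq hz]
    intro l hl
    exact h1 (l * k) (by rw [hl, ← hkq, Nat.cast_mul l k, mul_assoc])

theorem order_rescale {K : Type*} [Field K] {z : K} (hz : z ≠ 0) (p : PowerSeries K) :
    (PowerSeries.rescale z p).order = p.order := by
  refine le_antisymm (PowerSeries.le_order _ _ fun i hi => ?_)
    (PowerSeries.le_order _ _ fun i hi => ?_)
  · have := PowerSeries.coeff_of_lt_order i hi
    rw [PowerSeries.coeff_rescale] at this
    exact (mul_eq_zero.1 this).resolve_left (pow_ne_zero _ hz)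
  · rw [PowerSeries.coeff_rescale, PowerSeries.coeff_of_lt_order i hi, mul_zero]

theorem subst_localEquation (G : MvPolynomial (Fin 3) ℂ) (a b : PowerSeries ℂ) :
    subst ![a, b] (localEquation G : MvPowerSeries (Fin 2) ℂ) =
      MvPolynomial.aeval (![a, b, 1] : Fin 3 → PowerSeries ℂ) G := by
  rw [subst_coe, localEquation, ← AlgHom.comp_apply, MvPolynomial.comp_aeval]
  congr 2
  funext i
  fin_cases i <;> simp

/-- Since `ζʲ` is an `e`-th root of unity, the conjugate parametrization arises from `x = t ^ e, y =
h(t)` by the single substitution `t ↦ ζʲ t ^ k`. The order is therefore multiplied by `k`, whatever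
`j` is. -/
theorem subst_branchRoot {e k : ℕ} (he : e ≠ 0) (hk : k ≠ 0) {h : PowerSeries ℂ}
    (hh : PowerSeries.constantCoeff h = 0) (j : ℕ) (g : MvPowerSeries (Fin 2) ℂ) :
    subst ![PowerSeries.X ^ (e * k), branchRoot (e * k) e h j] g =
      PowerSeries.expand k hk (PowerSeries.rescale (Complex.exp (2 * Real.pi * Complex.I / e) ^ j)
        (subst ![PowerSeries.X ^ e, h] g)) := by
  have hz : (Complex.exp (2 * Real.pi * Complex.I / e) ^ j) ^ e = 1 := by
    rw [pow_right_comm, (Complex.isPrimitiveRoot_exp e he).pow_eq_one, one_pow]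
  set z := Complex.exp (2 * Real.pi * Complex.I / e) ^ j with hzdef
  have h1 := hasSubst_pair (constantCoeff_powerSeriesX_pow (K := ℂ) he) hh
  have h2 : HasSubst (fun _ : Unit => (z • PowerSeries.X : PowerSeries ℂ)) :=
    hasSubst_of_constantCoeff_zero fun _ => by simp [constantCoeff_powerSeriesX]
  have h3 : HasSubst (fun _ : Unit => (PowerSeries.X ^ k : PowerSeries ℂ)) :=
    hasSubst_of_constantCoeff_zero fun _ => constantCoeff_powerSeriesX_pow hk
  have h4 : HasSubst (fun i => subst (fun _ : Unit => (z • PowerSeries.X : PowerSeries ℂ))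
      ((![PowerSeries.X ^ e, h] : Fin 2 → PowerSeries ℂ) i)) := by
    simpa only [substAlgHom_apply] using h1.comp h2
  rw [PowerSeries.expand_apply, PowerSeries.rescale_eq_subst, PowerSeries.subst, PowerSeries.subst,
    subst_comp_subst_apply h1 h2, subst_comp_subst_apply h4 h3]
  congr 1
  funext i
  fin_cases i
  · have h5 : subst (fun _ : Unit => (z • PowerSeries.X : PowerSeries ℂ))
        (PowerSeries.X ^ e : PowerSeries ℂ) = (PowerSeries.X ^ e : PowerSeries ℂ) := by
      have hX : subst (fun _ : Unit => (z • PowerSeries.X : PowerSeries ℂ))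
        (PowerSeries.X : PowerSeries ℂ) =
        (z • PowerSeries.X : PowerSeries ℂ) := subst_X h2 ()
      rw [subst_pow h2, hX, smul_pow, hz, one_smul]
    simp only [Fin.zero_eta, Matrix.cons_val_zero]
    have hX : subst (fun _ : Unit => (PowerSeries.X ^ k : PowerSeries ℂ))
        (PowerSeries.X : PowerSeries ℂ) =
      (PowerSeries.X ^ k : PowerSeries ℂ) := subst_X h3 ()
    rw [h5, subst_pow h3, hX, ← pow_mul, mul_comm]
  · simp only [Fin.mk_one, Matrix.cons_val_one, Matrix.cons_val_fin_one]
    rw [branchRoot_mul he, PowerSeries.rescale_eq_subst]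
    rfl

theorem order_subst_branchRoot {e k : ℕ} (he : e ≠ 0) (hk : k ≠ 0) {h : PowerSeries ℂ}
    (hh : PowerSeries.constantCoeff h = 0) (j : ℕ) (G : MvPolynomial (Fin 3) ℂ) :
    PowerSeries.order (subst ![PowerSeries.X ^ (e * k), branchRoot (e * k) e h j]
      (localEquation G : MvPowerSeries (Fin 2) ℂ)) =
      k * branchIntersection e h G := by
  rw [subst_branchRoot he hk hh, PowerSeries.order_expand,
    order_rescale (pow_ne_zero _ (Complex.exp_ne_zero _)), subst_localEquation, nsmul_eq_mul]
  rfl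

/-- The map `p(t) ↦ p(z x ^ q)` as a ring homomorphism. -/
noncomputable def hevalSingle (q : ℚ) (z : ℂ) : PowerSeries ℂ →+* Puiseux where
  toFun := PowerSeries.heval (HahnSeries.single q z)
  map_one' := map_one _
  map_mul' := map_mul _
  map_zero' := map_zero _
  map_add' := map_add _

theorem hevalSingle_apply (q : ℚ) (z : ℂ) (p : PowerSeries ℂ) :
    hevalSingle q z p = PowerSeries.heval (HahnSeries.single q z) p := rfl

theorem evalAlong_probranch {e k : ℕ} (he : e ≠ 0) (hk : k ≠ 0) (h : PowerSeries ℂ) (j : ℕ)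
    (G : MvPolynomial (Fin 3) ℂ) :
    evalAlong G (probranch e h j) =
      PowerSeries.heval (HahnSeries.single (1 / ((e * k : ℕ) : ℚ)) 1)
        (subst ![PowerSeries.X ^ (e * k), branchRoot (e * k) e h j]
          (localEquation G : MvPowerSeries (Fin 2) ℂ)) := by
  have hN : ((e * k : ℕ) : ℚ) ≠ 0 := by exact_mod_cast Nat.mul_ne_zero he hk
  have hpos : 0 < (HahnSeries.single (1 / ((e * k : ℕ) : ℚ)) (1 : ℂ)).orderTop := by
    rw [HahnSeries.orderTop_single one_ne_zero]
    have : (0 : ℚ) < 1 / ((e * k : ℕ) : ℚ) := by positivity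
    exact_mod_cast this
  rw [subst_localEquation]
  have key : (MvPolynomial.aeval (![HahnSeries.single 1 1, probranch e h j, 1] : Fin 3 → Puiseux) :
      MvPolynomial (Fin 3) ℂ →ₐ[ℂ] Puiseux).toRingHom =
      (hevalSingle (1 / ((e * k : ℕ) : ℚ)) 1).comp
        (MvPolynomial.aeval (![PowerSeries.X ^ (e * k), branchRoot (e * k) e h j, 1] :
          Fin 3 → PowerSeries ℂ)).toRingHom := by
    refine MvPolynomial.ringHom_ext (fun a => ?_) (fun i => ?_)
    · have h1 : algebraMap ℂ Puiseux a = HahnSeries.C a := by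
        rw [HahnSeries.algebraMap_apply']
        exact HahnSeries.ofPowerSeries_C a
      have h2 := PowerSeries.heval_C (HahnSeries.single (1 / ((e * k : ℕ) : ℚ)) (1 : ℂ)) a
      simp only [AlgHom.toRingHom_eq_coe, RingHom.coe_coe, RingHom.comp_apply,
        MvPolynomial.aeval_C, h1, PowerSeries.algebraMap_eq, hevalSingle_apply, h2]
      ext r
      rw [HahnSeries.coeff_smul, HahnSeries.C_apply, HahnSeries.coeff_single, HahnSeries.coeff_one]
      split_ifs <;> simp
    · simp only [AlgHom.toRingHom_eq_coe, RingHom.coe_coe, RingHom.comp_apply,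
        MvPolynomial.aeval_X]
      fin_cases i
      · simp only [Fin.zero_eta, Matrix.cons_val_zero, map_pow, hevalSingle_apply]
        rw [PowerSeries.heval_X _ hpos, HahnSeries.single_pow, one_pow, nsmul_eq_mul,
          mul_one_div_cancel hN]
      · exact (heval_branchRoot he hk h j).symm
      · exact (map_one (hevalSingle _ 1)).symm
  exact DFunLike.congr_fun key G

theorem toRat_top : toRat ⊤ = ⊤ := rfl

theorem toRat_natCast (n : ℕ) : toRat n = ((n : ℚ) : WithTop ℚ) := rfl

theorem toRat_sum {ι : Type*} (s : Finset ι) (f : ι → ℕ∞) :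
    toRat (∑ i ∈ s, f i) = ∑ i ∈ s, toRat (f i) := by
  classical
  induction s using Finset.induction_on with
  | empty => simp [toRat]
  | insert a s ha ih =>
    rw [Finset.sum_insert ha, Finset.sum_insert ha, ← ih]
    exact ENat.map_add (Nat.castAddMonoidHom ℚ) _ _

/-- All `e` conjugates give the same valuation, namely the order in `t` divided by `e`. -/
theorem toRat_branchIntersection {e : ℕ} (he : e ≠ 0) {h : PowerSeries ℂ}
    (hh : PowerSeries.constantCoeff h = 0) (G : MvPolynomial (Fin 3) ℂ) :
    toRat (branchIntersection e h G) =
      ∑ j ∈ Finset.range e, (evalAlong G (probranch e h j)).orderTop := by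
  have he' : (0 : ℚ) < e := by exact_mod_cast Nat.pos_of_ne_zero he
  have hq : (0 : ℚ) < 1 / ((e * 1 : ℕ) : ℚ) := by
    rw [mul_one]
    positivity
  have h1 (j : ℕ) : (evalAlong G (probranch e h j)).orderTop =
      ENat.map (fun k : ℕ => (k : ℚ) * (1 / ((e * 1 : ℕ) : ℚ))) (branchIntersection e h G) := by
    rw [evalAlong_probranch he one_ne_zero, orderTop_heval_single hq one_ne_zero,
      order_subst_branchRoot he one_ne_zero hh, Nat.cast_one, one_mul]
  simp only [h1, Finset.sum_const, Finset.card_range]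
  cases branchIntersection e h G with
  | top =>
    -- The multiple `e • ⊤` is `⊤` only because `e` is positive.
    obtain ⟨n, rfl⟩ := Nat.exists_eq_succ_of_ne_zero he
    rw [ENat.map_top, succ_nsmul, add_top, toRat_top]
  | coe n =>
    rw [ENat.map_natCast, toRat_natCast, ← WithTop.coe_nsmul, nsmul_eq_mul, mul_one]
    congr 1
    field_simp

theorem orderTop_heval_isUnit {q : ℚ} (hq : 0 < q) {u : PowerSeries ℂ} (hu : IsUnit u) :
    (PowerSeries.heval (HahnSeries.single q 1) u).orderTop = 0 := by
  rw [orderTop_heval_single hq one_ne_zero, PowerSeries.order_zero_of_unit hu]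
  simp

theorem orderTop_prod {ι : Type*} (s : Finset ι) (f : ι → Puiseux) :
    (∏ i ∈ s, f i).orderTop = ∑ i ∈ s, (f i).orderTop := by
  classical
  induction s using Finset.induction_on with
  | empty => simp
  | insert a s ha ih =>
    rw [Finset.prod_insert ha, Finset.sum_insert ha, HahnSeries.orderTop_mul, ih]

end Puiseux

/-! ### Extension of the coefficient field, used from `ℂ` to `ℂ(z)` -/

section BaseChange

variable {K L : Type*} [Field K] [Field L] (φ : K →+* L)

theorem map_ramify {N : ℕ} (hN : N ≠ 0) (f : MvPowerSeries (Fin 2) K) :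
    map φ (ramify hN f) = ramify hN (map φ f) := by
  refine ext_expo fun i j => ?_
  rw [coeff_map, coeff_ramify, coeff_ramify, coeff_map, apply_ite φ, map_zero]

theorem map_linearFactor (c : PowerSeries K) :
    map φ (linearFactor c) = linearFactor (PowerSeries.map φ c) := by
  rw [linearFactor, linearFactor, map_sub, map_X]
  congr 1
  exact (rename_map _ φ c).symm

theorem map_evalAt {c : PowerSeries K} (hc : PowerSeries.constantCoeff c = 0)
    (hc' : PowerSeries.constantCoeff (PowerSeries.map φ c) = 0) (f : MvPowerSeries (Fin 2) K) :
    evalAt (PowerSeries.map φ c) hc' (map φ f) = PowerSeries.map φ (evalAt c hc f) := by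
  rw [evalAt_apply, evalAt_apply]
  refine Eq.trans ?_ (map_subst (hasSubst_pair constantCoeff_powerSeriesX hc) f).symm
  congr 1
  funext i
  fin_cases i
  · exact (PowerSeries.map_X φ).symm
  · rfl

theorem order_map_field (p : PowerSeries K) : (PowerSeries.map φ p).order = p.order := by
  refine le_antisymm (PowerSeries.le_order _ _ fun i hi => ?_) (PowerSeries.le_order_map φ)
  have := PowerSeries.coeff_of_lt_order i hi
  rwa [PowerSeries.coeff_map, map_eq_zero_iff φ φ.injective] at this

end BaseChange

/-! ### The intersection number as a sum over branches and probranches -/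

section Main

theorem natCast_mul_left_cancel {N : ℕ} (hN : N ≠ 0) {a b : ℕ∞} (h : (N : ℕ∞) * a = N * b) :
    a = b := by
  have h0 : (N : ℕ∞) ≠ 0 := by exact_mod_cast hN
  cases a with
  | top =>
    cases b with
    | top => rfl
    | coe b =>
      rw [ENat.mul_top h0, ← Nat.cast_mul] at h
      exact absurd h.symm (ENat.natCast_ne_top _)
  | coe a =>
    cases b with
    | top =>
      rw [ENat.mul_top h0, ← Nat.cast_mul] at h
      exact absurd h (ENat.natCast_ne_top _)
    | coe b =>
      have h' : N * a = N * b := by exact_mod_cast h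
      rw [Nat.eq_of_mul_eq_mul_left (Nat.pos_of_ne_zero hN) h']

theorem exists_ramify_eq_prod {B : ConvergentSeries (Fin 2)} (hB : Irreducible B)
    (hord : (restrictY (B : MvPowerSeries (Fin 2) ℂ)).order = (B : MvPowerSeries (Fin 2) ℂ).order)
    {h : PowerSeries ℂ} (hh : IsParametrization B h) {N : ℕ} (hN : N ≠ 0)
    (hd : branchMultiplicity B ∣ N) :
    ∃ u : MvPowerSeries (Fin 2) ℂ, IsUnit u ∧
      ramify hN (B : MvPowerSeries (Fin 2) ℂ) =
        u * ∏ j ∈ Finset.range (branchMultiplicity B),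
          linearFactor (branchRoot N (branchMultiplicity B) h j) := by
  obtain ⟨k, rfl⟩ := hd
  have he := branchMultiplicity_ne_zero hB
  have hk : k ≠ 0 := right_ne_zero_of_mul hN
  have hord' : (restrictY (B : MvPowerSeries (Fin 2) ℂ)).order = branchMultiplicity B := by
    rw [hord, branchMultiplicity, ENat.natCast_toNat]
    rw [Ne, order_eq_top_iff]
    exact fun h0 => hB.ne_zero (Subtype.ext h0)
  obtain ⟨u, hu, hB'⟩ := ramify_eq_prod_linearFactor hB hord' hh (Complex.isPrimitiveRoot_exp _ he)
  refine ⟨ramify hN u, hu.map _, ?_⟩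
  rw [← ramify_mul he hk, hB', map_mul, ramify_mul, map_prod]
  congr 1
  refine Finset.prod_congr rfl fun j _ => ?_
  rw [ramify_linearFactor, branchRoot_mul he]

/-- The indices `(β, j)` of the probranches of a curve whose branches have multiplicities `e β`. -/
def probranchIndex {b : ℕ} (e : Fin b → ℕ) : Finset (Σ _ : Fin b, ℕ) :=
  Finset.univ.sigma fun β => Finset.range (e β)

theorem exists_ramify_localEquation {G : MvPolynomial (Fin 3) ℂ} (hT : ¬ lineX ⊆ tangentCone G)
    {b : ℕ} {B : Fin b → ConvergentSeries (Fin 2)} (hB : IsBranches G B) {h : Fin b → PowerSeries ℂ}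
    (hh : ∀ β, IsParametrization (B β) (h β)) {N : ℕ} (hN : N ≠ 0)
    (hd : ∀ β, branchMultiplicity (B β) ∣ N) :
    ∃ u : MvPowerSeries (Fin 2) ℂ, IsUnit u ∧
      ramify hN (localEquation G : MvPowerSeries (Fin 2) ℂ) =
        u * ∏ p ∈ probranchIndex fun β => branchMultiplicity (B β),
          linearFactor (branchRoot N (branchMultiplicity (B p.1)) (h p.1) p.2) := by
  obtain ⟨h0, hord⟩ := order_restrictY_localEquation hT
  obtain ⟨w, hw⟩ := hB.associated.symm
  have hf : (localEquation G : MvPowerSeries (Fin 2) ℂ) =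
      ((w : ConvergentSeries (Fin 2)) : MvPowerSeries (Fin 2) ℂ) *
        ∏ β, (B β : MvPowerSeries (Fin 2) ℂ) := by
    have := congrArg (ConvergentSeries (Fin 2)).val hw
    rw [map_mul, map_prod, mul_comm] at this
    exact this.symm
  have hwu := isUnit_coe w.isUnit
  choose u hu hBu using fun β => exists_ramify_eq_prod (hB.irreducible β)
    (order_restrictY_eq_of_prod hwu hf h0 hord β) (hh β) hN (hd β)
  refine ⟨ramify hN ((w : ConvergentSeries (Fin 2)) : MvPowerSeries (Fin 2) ℂ) * ∏ β, u β,
    (hwu.map _).mul (IsUnit.prod_univ_iff.2 hu), ?_⟩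
  rw [hf, map_mul, map_prod, Finset.prod_congr rfl fun β _ => hBu β, Finset.prod_mul_distrib,
    probranchIndex, Finset.prod_sigma, mul_assoc]

theorem constantCoeff_branchRoot_of_dvd {N e : ℕ} (hN : N ≠ 0) (hd : e ∣ N) {h : PowerSeries ℂ}
    (hh : PowerSeries.constantCoeff h = 0) (j : ℕ) :
    PowerSeries.constantCoeff (branchRoot N e h j) = 0 := by
  obtain ⟨k, rfl⟩ := hd
  exact constantCoeff_branchRoot (left_ne_zero_of_mul hN) (right_ne_zero_of_mul hN) hh j

/-- Both sides are compared after multiplication by `N`: the branch `β` contributes `e_β` conjugate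
factors, each of order `N / e_β` times the branch intersection number. The factorisation is obtained
over `ℂ` and carried to `ℂ(z)`, where orders are the same. -/
theorem intersectionNumber_eq_sum_branchIntersection (M : GL (Fin 3) ℂ) {d d' : ℕ}
    {F F' : MvPolynomial (Fin 3) ℂ} (hF : F.IsHomogeneous d) (hF' : F'.IsHomogeneous d')
    (hT : ¬ lineX ⊆ tangentCone (comp F M)) {b : ℕ} {B : Fin b → ConvergentSeries (Fin 2)}
    (hB : IsBranches (comp F M) B) {h : Fin b → PowerSeries ℂ}
    (hh : ∀ β, IsParametrization (B β) (h β)) :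
    intersectionNumber (imageOrigin M) F F' =
      ∑ β, branchIntersection (branchMultiplicity (B β)) (h β) (comp F' M) := by
  have he (β : Fin b) := branchMultiplicity_ne_zero (hB.irreducible β)
  set N := ∏ β, branchMultiplicity (B β) with hNdef
  have hN : N ≠ 0 := Finset.prod_ne_zero_iff.2 fun β _ => he β
  have hd (β : Fin b) : branchMultiplicity (B β) ∣ N :=
    Finset.dvd_prod_of_mem (fun β => branchMultiplicity (B β)) (Finset.mem_univ β)
  obtain ⟨u, hu, hf⟩ := exists_ramify_localEquation hT hB hh hN hd
  set c : (Σ _ : Fin b, ℕ) → PowerSeries ℂ := fun p =>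
    branchRoot N (branchMultiplicity (B p.1)) (h p.1) p.2 with hc
  have hc0 (p) : PowerSeries.constantCoeff (c p) = 0 :=
    constantCoeff_branchRoot_of_dvd hN (hd p.1) (hh p.1).constantCoeff _
  set φ := algebraMap ℂ ConeField
  have hc0' (p) : PowerSeries.constantCoeff (PowerSeries.map φ (c p)) = 0 := by
    rw [← PowerSeries.coeff_zero_eq_constantCoeff_apply, PowerSeries.coeff_map,
      PowerSeries.coeff_zero_eq_constantCoeff_apply, hc0, map_zero]
  have key := length_quotient_eq_sum (probranchIndex fun β => branchMultiplicity (B β)) hN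
    (map φ (localEquation (comp F M) : MvPowerSeries (Fin 2) ℂ))
    (map φ (localEquation (comp F' M) : MvPowerSeries (Fin 2) ℂ)) (map φ u) (hu.map _)
    (fun p => PowerSeries.map φ (c p)) hc0' (by
      rw [← map_ramify, hf, map_mul, map_prod]
      simp only [map_linearFactor, hc])
  rw [← intersectionNumber_eq_length M hF hF'] at key
  have hsum : ∑ p ∈ probranchIndex fun β => branchMultiplicity (B β),
      (evalAt (PowerSeries.map φ (c p)) (hc0' p)
        (ramify hN (map φ (localEquation (comp F' M) : MvPowerSeries (Fin 2) ℂ)))).order =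
      N * ∑ β, branchIntersection (branchMultiplicity (B β)) (h β) (comp F' M) := by
    rw [probranchIndex, Finset.sum_sigma, Finset.mul_sum]
    refine Finset.sum_congr rfl fun β _ => ?_
    obtain ⟨k, hk⟩ := hd β
    have hk0 : k ≠ 0 := right_ne_zero_of_mul (hk ▸ hN)
    have hterm (j : ℕ) : (evalAt (PowerSeries.map φ (c ⟨β, j⟩)) (hc0' ⟨β, j⟩)
        (ramify hN (map φ (localEquation (comp F' M) : MvPowerSeries (Fin 2) ℂ)))).order =
        k * branchIntersection (branchMultiplicity (B β)) (h β) (comp F' M) := by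
      rw [← map_ramify, map_evalAt φ (hc0 ⟨β, j⟩), order_map_field, evalAt_ramify,
        ← order_subst_branchRoot (he β) hk0 (hh β).constantCoeff j, ← hk]
    rw [Finset.sum_congr rfl fun j _ => hterm j, Finset.sum_const, Finset.card_range, nsmul_eq_mul,
      ← mul_assoc, ← Nat.cast_mul, ← hk]
  rw [hsum] at key
  exact natCast_mul_left_cancel hN key

/-- Substituting the probranch for `y` in the factorised equation of `G` turns each factor `y - c`
into a difference of probranches, and the unit has valuation `0`. -/
theorem orderTop_evalAlong_probranch {G : MvPolynomial (Fin 3) ℂ}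
    (hT : ¬ lineX ⊆ tangentCone G) {b : ℕ} {B : Fin b → ConvergentSeries (Fin 2)}
    (hB : IsBranches G B) {h : Fin b → PowerSeries ℂ} (hh : ∀ β, IsParametrization (B β) (h β))
    {e : ℕ} (he : e ≠ 0) {g : PowerSeries ℂ} (hg : PowerSeries.constantCoeff g = 0) (j : ℕ) :
    (evalAlong G (probranch e g j)).orderTop =
      ∑ β, ∑ j' ∈ Finset.range (branchMultiplicity (B β)),
        (probranch e g j - probranch (branchMultiplicity (B β)) (h β) j').orderTop := by
  have he' (β : Fin b) := branchMultiplicity_ne_zero (hB.irreducible β)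
  -- The exponent `e * k` is a common multiple of `e` and of all branch multiplicities of `G`, so
  -- the given probranch and those of `G` are power series in the same `t`.
  set k := ∏ β, branchMultiplicity (B β) with hk
  have hk0 : k ≠ 0 := Finset.prod_ne_zero_iff.2 fun β _ => he' β
  have hN : e * k ≠ 0 := mul_ne_zero he hk0
  have hd (β : Fin b) : branchMultiplicity (B β) ∣ e * k :=
    (Finset.dvd_prod_of_mem (fun β => branchMultiplicity (B β)) (Finset.mem_univ β)).mul_left e
  have hq : (0 : ℚ) < 1 / ((e * k : ℕ) : ℚ) :=
    one_div_pos.2 (by exact_mod_cast Nat.pos_of_ne_zero hN)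
  have hc := constantCoeff_branchRoot he hk0 hg j
  obtain ⟨u, hu, hf⟩ := exists_ramify_localEquation hT hB hh hN hd
  rw [evalAlong_probranch he hk0, ← evalAt_ramify hN _ hc, hf, map_mul, map_prod, map_mul,
    HahnSeries.orderTop_mul, orderTop_heval_isUnit hq (hu.map _), zero_add, map_prod, orderTop_prod,
    probranchIndex, Finset.sum_sigma]
  refine Finset.sum_congr rfl fun β _ => Finset.sum_congr rfl fun j' _ => ?_
  rw [evalAt_linearFactor, map_sub, heval_branchRoot he hk0]
  obtain ⟨l, hl⟩ := hd β
  rw [hl, heval_branchRoot (he' β) (right_ne_zero_of_mul (hl ▸ hN))]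

end Main

end PlaneCurve

theorem mainTheorem6 (m : PlaneCurve.Plane) (d d' : ℕ) (F F' : MvPolynomial (Fin 3) ℂ)
    (hF : F.IsHomogeneous d) (hF' : F'.IsHomogeneous d') (hF0 : F ≠ 0) (hF0' : F' ≠ 0)
    (hm : m ∈ PlaneCurve.zeroLocus F) (hm' : m ∈ PlaneCurve.zeroLocus F')
    (M : GL (Fin 3) ℂ) (hM : PlaneCurve.imageOrigin M = m)
    (hT : ¬ PlaneCurve.lineX ⊆ PlaneCurve.tangentCone (PlaneCurve.comp F M))
    (hT' : ¬ PlaneCurve.lineX ⊆ PlaneCurve.tangentCone (PlaneCurve.comp F' M))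
    (b b' : ℕ) (B : Fin b → PlaneCurve.ConvergentSeries (Fin 2))
    (B' : Fin b' → PlaneCurve.ConvergentSeries (Fin 2))
    (hB : PlaneCurve.IsBranches (PlaneCurve.comp F M) B)
    (hB' : PlaneCurve.IsBranches (PlaneCurve.comp F' M) B')
    (e : Fin b → ℕ) (e' : Fin b' → ℕ)
    (he : ∀ β, e β = PlaneCurve.branchMultiplicity (B β))
    (he' : ∀ β', e' β' = PlaneCurve.branchMultiplicity (B' β'))
    (h : Fin b → PowerSeries ℂ) (h' : Fin b' → PowerSeries ℂ)
    (hh : ∀ β, PlaneCurve.IsParametrization (B β) (h β))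
    (hh' : ∀ β', PlaneCurve.IsParametrization (B' β') (h' β')) :
    PlaneCurve.toRat (PlaneCurve.intersectionNumber m F F') =
        ∑ β, ∑ j ∈ Finset.range (e β), ∑ β', ∑ j' ∈ Finset.range (e' β'),
          (PlaneCurve.probranch (e β) (h β) j -
            PlaneCurve.probranch (e' β') (h' β') j').orderTop ∧
      PlaneCurve.intersectionNumber m F F' =
        ∑ β, PlaneCurve.branchIntersection (e β) (h β) (PlaneCurve.comp F' M) ∧
      ∀ β, PlaneCurve.toRat
          (PlaneCurve.branchIntersection (e β) (h β) (PlaneCurve.comp F' M)) =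
        ∑ j ∈ Finset.range (e β),
          (PlaneCurve.evalAlong (PlaneCurve.comp F' M)
            (PlaneCurve.probranch (e β) (h β) j)).orderTop := by
  subst hM
  obtain rfl : e = fun β => PlaneCurve.branchMultiplicity (B β) := funext he
  obtain rfl : e' = fun β => PlaneCurve.branchMultiplicity (B' β) := funext he'
  have he0 (β : Fin b) := PlaneCurve.branchMultiplicity_ne_zero (hB.irreducible β)
  have h2 := PlaneCurve.intersectionNumber_eq_sum_branchIntersection M hF hF' hT hB hh
  have h3 (β : Fin b) := PlaneCurve.toRat_branchIntersection (he0 β) (hh β).constantCoeff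
    (PlaneCurve.comp F' M)
  refine ⟨?_, h2, h3⟩
  rw [h2, PlaneCurve.toRat_sum]
  refine Finset.sum_congr rfl fun β _ => ?_
  rw [h3]
  exact Finset.sum_congr rfl fun j _ =>
    PlaneCurve.orderTop_evalAlong_probranch hT' hB' hh' (he0 β) (hh β).constantCoeff j
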